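/- **Setting.** Let $\mathcal X\subset\mathbb R$ be compact with positive Lebesgue measure, $x_1,x_2,\ldots\in\mathcal X$ fixed covariates, and $y_{ij}$ ($i,j\ge1$) real responses; $\mathbf X_n=(x_1,\ldots,x_n)$, $\mathbf Y_{nm}=(y_{ij})_{i\le n,j\le m}$, $\mathbf y_i=(y_{i1},\ldots,y_{im})$. A model $\mathcal M$ consists of a parameter space $\Theta$, a prior probability $\pi$ on it and conditional densities $f(\cdot\mid\theta,x_i,y_{1j},\ldots,y_{i-1,j})$ of $y_{ij}$ with respect to a common $\sigma$-finite measure, so that $f(\mathbf Y_{nm}\mid\mathbf X_n,\theta)=\prod_{i\le n}\prod_{j\le m}f(y_{ij}\mid\theta,x_i,y_{1j},\ldots,y_{i-1,j})$. The responses are generated from the marginal distribution $P$ of a true model $\mathcal M_0$ of this form, which need not be among the competing models $\mathcal M_1,\ldots,\mathcal M_K$, $1<K<\infty$. The models are mixed: $P(\zeta=k\mid p)=p_k$, with a prior on $(p_1,\ldots,p_K)$ in the simplex, and given $\zeta=k$ the data follow $\mathcal M_k$ with prior $\pi_k$ on $\Theta_k$. **Divergence.** For fixed $m$ let $R_n(\theta)=f(\mathbf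 Y_{nm}\mid\mathbf X_n,\theta,\mathcal M_k)/f(\mathbf Y_{nm}\mid\mathbf X_n,\mathcal M_0)$, let $h_k(\theta)=\lim_n n^{-1}\mathrm{KL}$ be the Kullback-Leibler divergence rate of the law of $\mathbf Y_{nm}$ given $\theta$ from its true law, and let $h_k(A)=\operatorname{ess\,inf}_{\theta\in A}h_k(\theta)$ with respect to $\pi_k$. Assume Shalizi's conditions for every $k$ and every $m\ge2$: (S1) $R_n(\theta)$ is jointly measurable; (S2) $h_k(\theta)\in[0,\infty]$ exists and is measurable; (S3) $n^{-1}\log R_n(\theta)\to-h_k(\theta)$ a.s. for every $\theta$; (S4) $\pi_k(I)<1$ for $I=\{h_k=\infty\}$; and there are measurable $\mathcal G_n\to\Theta_k$ such that (S5) $\pi_k(\mathcal G_n)\ge1-Ce^{-\gamma n}$ with $C>0$ and $\gamma>2h_k(\Theta_k)$, the convergence in (S3) is almost surely uniform on each $\mathcal G_N\setminus I$ and $n^{-1}\log R_n\to-\infty$ uniformly on each $\mathcal G_N\cap I$, and $h_k(\mathcal G_n)\to h_k(\Theta_k)$; (S6) for every measurable $A$ with $\pi_k(A)>0$ and every $\delta>0$,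 almost surely, for all large $n$ and all $t\ge n$, $t^{-1}\log\int_{\mathcal G_n\cap A}R_t\,d\pi_k\le\delta+\max\{\limsup_s s^{-1}\log\int_{\mathcal G_n\cap A}R_s\,d\pi_k,\,-1/\delta\}$; (S7) $h_k(\mathcal G_n\cap A)\to h_k(A)$ for all such $A$. Let $\tilde k$ be the best model, $h_{\tilde k}(\Theta_{\tilde k})<h_k(\Theta_k)$ for all $k\ne\tilde k$ and all $m\ge2$, and let $E(p_{\tilde k})>0$. Let $\tilde\Theta_k\subset\Theta_k$ be measurable with $h_k(\tilde\Theta_k^c)>h_k(\Theta_k)$ for all $m\ge2$. **Inverse part.** Let $\bar y_i,s_i$ be the mean and standard deviation (divisor $m-1$) of $\mathbf y_i$. Given $\theta\in\Theta_k$, which has as a part a function $\eta$ of the covariate, the unknown covariate $\tilde x_i$ has the uniform prior on $B_{im}(\theta)=\{x\in\mathcal X: H_k(\eta(x))\in[\bar y_i-bs_i/\sqrt m,\ \bar y_i+bs_i/\sqrt m]\}$, $b\ge1$ (uniform on $\mathcal X$ if $B_{im}(\theta)$ is a null set). The restricted inverse cross-validation posterior of $\tilde x_i$ under $\mathcal M_k$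 has density $$\frac{\int_{\tilde\Theta_k}\pi(\tilde x_i\mid\theta,\mathbf y_i)\,d\pi(\theta\mid\mathbf X_{n,-i},\mathbf Y_{nm})}{\pi(\tilde\Theta_k\mid\mathbf X_{n,-i},\mathbf Y_{nm})},$$ where $x_i$ is treated as unknown, with the prior above; it is assumed to be well defined almost surely (the normalizing constants $\int_{\tilde\Theta_k}(\cdot)\,d\pi_k$ are positive and finite). Write $E_i,V_i$ for its mean and variance, and for some $c>0$ let $T^{(k)}(\mathbf v_n)=\frac1n\sum_i|v_i-E_i|/\sqrt{V_i+c}$, or, for all $k$, $T^{(k)}(\mathbf v_n)=\frac1n\sum_i(v_i-E_i)^2/(V_i+c)$. Let $\tilde{\mathbf X}_n=(\tilde x_1,\ldots,\tilde x_n)$ have independent coordinates with these posteriors, let $[\tilde\ell_{knm},\tilde u_{knm}]$ (measurable functions of the data) have posterior probability at least $1-\alpha$ for $T^{(k)}(\tilde{\mathbf X}_n)$, $0<\alpha<1$, and let the constants $a_k$ be the values of the almost sure iterated limit of $T^{(k)}(\mathbf X_n)$ as $n\to\infty$ and then $m\to\infty$. Let $\varepsilon>0$. **Tests.** Consider $H_{0k}$: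 $\zeta=k$, $\theta_k\in\tilde\Theta_k$ and $T^{(k)}(\tilde{\mathbf X}_n)-T^{(k)}(\mathbf X_n)\in[\tilde\ell_{knm}-a_k-\varepsilon,\ \tilde u_{knm}-a_k+\varepsilon]$, and its complement $H_{1k}$, with posterior probability $$v_{knm}=\pi(\zeta\ne k)+\pi(\zeta=k)\,\pi(\tilde\Theta_k^c\mid\mathcal M_k)+\pi(\zeta=k)\,\pi(\tilde\Theta_k\mid\mathcal M_k)\,\pi\bigl(T^{(k)}(\tilde{\mathbf X}_n)-T^{(k)}(\mathbf X_n)\notin[\,\cdot\,,\cdot\,]\mid\mathcal M_k,\tilde\Theta_k\bigr),$$ all given $\mathbf X_n,\mathbf Y_{nm}$. The $k$-th hypothesis is rejected ($\hat d_k=1$) if $v_{knm}>\beta_{nm}$ and not rejected ($\hat d_k=0$) otherwise, where $0<\beta_{nm}<1$, $\liminf_{n,m}\beta_{nm}>0$ and $\limsup_{n,m}\beta_{nm}<1$. With $\delta(\mathbf d)=1$ if $\mathbf d=\hat{\mathbf d}$ and $0$ otherwise, let $$cFNR_{nm}=\sum_{\mathbf d\in\{0,1\}^K}\frac{\sum_{k}(1-d_k)v_{knm}}{\max\{\sum_{k}(1-d_k),1\}}\,\delta(\mathbf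 d),$$ and let $pBFNR_{nm}$ be its expectation with respect to the distribution of $\mathbf Y_{nm}$ given $\mathbf X_n$. **Theorem.** Almost surely, for all sufficiently large $m$, $\lim_{n\to\infty}cFNR_{nm}=0$; in particular $\lim_{m\to\infty}\lim_{n\to\infty}cFNR_{nm}=0$ almost surely. Almost surely, for all sufficiently large $m$ and then all sufficiently large $n$, $cFNR_{nm}=v_{\tilde knm}$. Moreover $pBFNR_{nm}\to0$ as $n\to\infty$ and then $m\to\infty$, that is, $\lim_{m\to\infty}\limsup_{n\to\infty}pBFNR_{nm}=0$. -/

import Mathlib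

open MeasureTheory ProbabilityTheory Filter Topology Set
open scoped ENNReal NNReal

/-- The responses `y i j`, `i < n`, `j < m` (indices start at `0`): `m` responses are recorded at each
of the `n` covariate values. -/
abbrev Resp (n m : ℕ) : Type := Fin n → Fin m → ℝ

/-- The history `y 0 j, …, y (i-1) j` of the `j`-th replicate before index `i`. -/
def hist {n m : ℕ} (D : Resp n m) (i : Fin n) (j : Fin m) : Fin i → ℝ :=
  fun r => D ⟨r, r.2.trans i.2⟩ j

/-- A Bayesian response model: a prior probability on the parameter space `Θ`, and conditional densities
`dens i θ x hist y = f(y | θ, x, hist)` of the response number `i`, given the parameter, the covariate and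
the earlier responses of the same replicate, with respect to a common dominating measure `ν`. -/
structure RespModel (Θ : Type*) [MeasurableSpace Θ] (𝒳 : Set ℝ) (ν : Measure ℝ) where
  prior : Measure Θ
  prior_prob : IsProbabilityMeasure prior
  dens : (i : ℕ) → Θ → ℝ → (Fin i → ℝ) → ℝ → ℝ≥0
  dens_meas : ∀ i, Measurable
    (fun p : Θ × ℝ × (Fin i → ℝ) × ℝ => dens i p.1 p.2.1 p.2.2.1 p.2.2.2)
  dens_prob : ∀ i θ, ∀ x ∈ 𝒳, ∀ g, ∫⁻ y, dens i θ x g y ∂ν = 1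

/-- A competing inverse regression model: moreover a part `η` of the parameter is a function of the
covariate, and `H` is the transformation of `η(x)` that enters the prior of an unknown covariate. -/
structure InvModel (Θ : Type*) [MeasurableSpace Θ] (𝒳 : Set ℝ) (ν : Measure ℝ)
    extends RespModel Θ 𝒳 ν where
  η : Θ → ℝ → ℝ
  η_meas : Measurable (fun p : Θ × ℝ => η p.1 p.2)
  H : ℝ → ℝ
  H_meas : Measurable H

noncomputable section

namespace RespModel

variable {Θ : Type*} [MeasurableSpace Θ] {𝒳 : Set ℝ} {ν : Measure ℝ} (M : RespModel Θ 𝒳 ν)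

/-- `f(y_i | θ, x_i)`: the density of the block `y_i = (y_{i1}, …, y_{im})` when the covariate is `xi`. -/
def block {n m : ℕ} (D : Resp n m) (θ : Θ) (i : Fin n) (xi : ℝ) : ℝ≥0∞ :=
  ∏ j, (M.dens i θ xi (hist D i j) (D i j) : ℝ≥0∞)

/-- `f(Y_nm | X_n, θ)`. -/
def lik (x : ℕ → ℝ) {n m : ℕ} (θ : Θ) (D : Resp n m) : ℝ≥0∞ :=
  ∏ i, M.block D θ i (x i)

/-- The marginal density of `Y_nm` given `X_n`. -/
def marg (x : ℕ → ℝ) {n m : ℕ} (D : Resp n m) : ℝ≥0∞ :=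
  ∫⁻ θ, M.lik x θ D ∂M.prior

/-- The law of `Y_nm` given `X_n` and `θ`. -/
def lawGiven (x : ℕ → ℝ) (n m : ℕ) (θ : Θ) : Measure (Resp n m) :=
  (Measure.pi fun _ => Measure.pi fun _ => ν).withDensity (M.lik x θ)

/-- The marginal law of `Y_nm` given `X_n`. -/
def law (x : ℕ → ℝ) (n m : ℕ) : Measure (Resp n m) :=
  (Measure.pi fun _ => Measure.pi fun _ => ν).withDensity (M.marg x)

/-- The posterior probability `π(θ ∈ S | X_n, Y_nm)` under the model. -/
def post (x : ℕ → ℝ) {n m : ℕ} (D : Resp n m) (S : Set Θ) : ℝ≥0∞ :=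
  (∫⁻ θ in S, M.lik x θ D ∂M.prior) / M.marg x D

/-- The Kullback-Leibler divergence rate `h(θ)` from the true model `M₀`, as `n → ∞` with `m` fixed. -/
def klRate {Θ₀ : Type*} [MeasurableSpace Θ₀] (M₀ : RespModel Θ₀ 𝒳 ν) (x : ℕ → ℝ) (m : ℕ) (θ : Θ) :
    ℝ≥0∞ :=
  limsup (fun n : ℕ => InformationTheory.klDiv (M₀.law x n m) (M.lawGiven x n m θ) / n) atTop

/-- `h(A)`: the essential infimum over `A`, with respect to the prior, of the divergence rate. -/
def klInf {Θ₀ : Type*} [MeasurableSpace Θ₀] (M₀ : RespModel Θ₀ 𝒳 ν) (x : ℕ → ℝ) (m : ℕ) (A : Set Θ) :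
    ℝ≥0∞ :=
  essInf (M.klRate M₀ x m) (M.prior.restrict A)

/-- The likelihood ratio `R_n(θ)` of the model against the true model. -/
def ratio {Θ₀ : Type*} [MeasurableSpace Θ₀] (M₀ : RespModel Θ₀ 𝒳 ν) (x : ℕ → ℝ) {n m : ℕ} (θ : Θ)
    (D : Resp n m) : ℝ≥0∞ :=
  M.lik x θ D / M₀.marg x D

/-- `n⁻¹ log ∫_A R_n(θ) π(dθ)`. -/
def logInt {Θ₀ : Type*} [MeasurableSpace Θ₀] (M₀ : RespModel Θ₀ 𝒳 ν) (x : ℕ → ℝ) {n m : ℕ} (A : Set Θ)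
    (D : Resp n m) : EReal :=
  ENNReal.log (∫⁻ θ in A, M.ratio M₀ x θ D ∂M.prior) / (n : EReal)

end RespModel

/-- The observed responses `Y_nm` of the double array `y`. -/
def obs {Ω : Type*} (y : ℕ → ℕ → Ω → ℝ) (n m : ℕ) (ω : Ω) : Resp n m :=
  fun i j => y i j ω

/-- Shalizi's conditions (S1)-(S7) for the model `M`, the true model `M₀` and `m` replicates, the
observations being the blocks `(y i 0, …, y i (m-1))`, `i = 0, 1, …`. -/
structure Shalizi {Θ Θ₀ Ω : Type*} [MeasurableSpace Θ] [MeasurableSpace Θ₀] [MeasurableSpace Ω]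
    {𝒳 : Set ℝ} {ν : Measure ℝ} (M : RespModel Θ 𝒳 ν) (M₀ : RespModel Θ₀ 𝒳 ν) (x : ℕ → ℝ)
    (P : Measure Ω) (y : ℕ → ℕ → Ω → ℝ) (m : ℕ) : Prop where
  s1 : ∀ n, Measurable (fun p : Θ × Resp n m => M.ratio M₀ x p.1 p.2)
  s2_lim : ∀ θ, Tendsto
    (fun n : ℕ => InformationTheory.klDiv (M₀.law x n m) (M.lawGiven x n m θ) / n) atTop
    (𝓝 (M.klRate M₀ x m θ))
  s2_meas : Measurable (M.klRate M₀ x m)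
  s3 : ∀ θ, ∀ᵐ ω ∂P, Tendsto
    (fun n : ℕ => ENNReal.log (M.ratio M₀ x θ (obs y n m ω)) / (n : EReal)) atTop
    (𝓝 (-(M.klRate M₀ x m θ : EReal)))
  s4 : M.prior {θ | M.klRate M₀ x m θ = ∞} < 1
  s567 : ∃ G : ℕ → Set Θ,
    (∀ n, MeasurableSet (G n)) ∧ (∀ θ, ∀ᶠ n in atTop, θ ∈ G n) ∧
    -- (S5)(1)
    (∃ C γ : ℝ, 0 < C ∧ 2 * M.klInf M₀ x m univ < ENNReal.ofReal γ ∧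
      ∀ n : ℕ, 1 - C * Real.exp (-γ * n) ≤ M.prior.real (G n)) ∧
    -- (S5)(2): the convergence in (S3) is uniform on each `G N`, where the rate is finite
    (∀ N, ∀ᵐ ω ∂P, ∀ δ : ℝ, 0 < δ → ∀ᶠ n : ℕ in atTop, ∀ θ ∈ G N, M.klRate M₀ x m θ ≠ ∞ →
      -(M.klRate M₀ x m θ : EReal) - (δ : EReal) ≤
          ENNReal.log (M.ratio M₀ x θ (obs y n m ω)) / (n : EReal) ∧
        ENNReal.log (M.ratio M₀ x θ (obs y n m ω)) / (n : EReal) ≤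
          -(M.klRate M₀ x m θ : EReal) + (δ : EReal)) ∧
    -- and where the rate is infinite
    (∀ N, ∀ᵐ ω ∂P, ∀ B : ℝ, ∀ᶠ n : ℕ in atTop, ∀ θ ∈ G N, M.klRate M₀ x m θ = ∞ →
      ENNReal.log (M.ratio M₀ x θ (obs y n m ω)) / (n : EReal) ≤ (B : EReal)) ∧
    -- (S5)(3)
    Tendsto (fun n => M.klInf M₀ x m (G n)) atTop (𝓝 (M.klInf M₀ x m univ)) ∧
    -- (S6): eventually `n > τ(G n ∩ A, δ)`; the number `-δ⁻¹` matters only if the upper limit is `-∞`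
    (∀ A, MeasurableSet A → 0 < M.prior A → ∀ δ : ℝ, 0 < δ → ∀ᵐ ω ∂P, ∀ᶠ n in atTop, ∀ t ≥ n,
      M.logInt M₀ x (G n ∩ A) (obs y t m ω) ≤
        (δ : EReal) + max (limsup (fun s => M.logInt M₀ x (G n ∩ A) (obs y s m ω)) atTop)
          ((-δ⁻¹ : ℝ) : EReal)) ∧
    -- (S7)
    (∀ A, MeasurableSet A → 0 < M.prior A →
      Tendsto (fun n => M.klInf M₀ x m (G n ∩ A)) atTop (𝓝 (M.klInf M₀ x m A)))

/-- The mean `ȳ_i`. -/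
def blockMean {n m : ℕ} (D : Resp n m) (i : Fin n) : ℝ := (∑ j, D i j) / m

/-- The standard deviation `s_i`, with divisor `m - 1`. -/
def blockSD {n m : ℕ} (D : Resp n m) (i : Fin n) : ℝ :=
  √((∑ j, (D i j - blockMean D i) ^ 2) / ((m : ℝ) - 1))

namespace InvModel

variable {Θ : Type*} [MeasurableSpace Θ] {𝒳 : Set ℝ} {ν : Measure ℝ} (M : InvModel Θ 𝒳 ν)

/-- The set `B_im(θ) = {x ∈ 𝒳 : H(η(x)) ∈ [ȳ_i - b s_i / √m, ȳ_i + b s_i / √m]}`. -/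
def B (b : ℝ) {n m : ℕ} (D : Resp n m) (i : Fin n) (θ : Θ) : Set ℝ :=
  {x ∈ 𝒳 | M.H (M.η θ x) ∈ Icc (blockMean D i - b * blockSD D i / √m)
    (blockMean D i + b * blockSD D i / √m)}

open Classical in
/-- The density of the prior of `x̃_i`, the uniform distribution on `B_im(θ)`. If the data make
`B_im(θ)` a Lebesgue null set, then it is read as the uniform distribution on the covariate space. -/
def xPrior (b : ℝ) {n m : ℕ} (D : Resp n m) (i : Fin n) (θ : Θ) (x : ℝ) : ℝ≥0∞ :=
  if volume (M.B b D i θ) = 0 then 𝒳.indicator 1 x / volume 𝒳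
  else (M.B b D i θ).indicator 1 x / volume (M.B b D i θ)

/-- `∫ π(x̃_i | θ) f(y_i | θ, x̃_i) dx̃_i`. -/
def xEvid (b : ℝ) {n m : ℕ} (D : Resp n m) (i : Fin n) (θ : Θ) : ℝ≥0∞ :=
  ∫⁻ z, M.xPrior b D i θ z * M.block D θ i z

/-- The density `π(x̃_i | θ, y_i)` of the unknown covariate given the parameter. -/
def xPost (b : ℝ) {n m : ℕ} (D : Resp n m) (i : Fin n) (θ : Θ) (z : ℝ) : ℝ≥0∞ :=
  M.xPrior b D i θ z * M.block D θ i z / M.xEvid b D i θ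

/-- The likelihood of `θ` for the data `(X_{n,-i}, Y_nm)`, the covariate `x_i` being treated as unknown. -/
def cvLik (x : ℕ → ℝ) (b : ℝ) {n m : ℕ} (D : Resp n m) (i : Fin n) (θ : Θ) : ℝ≥0∞ :=
  (∏ l ∈ Finset.univ.erase i, M.block D θ l (x l)) * M.xEvid b D i θ

/-- The normalizing constant of the posterior of `θ` given `(X_{n,-i}, Y_nm)`, restricted to `S`. -/
def cvNorm (x : ℕ → ℝ) (b : ℝ) (S : Set Θ) {n m : ℕ} (D : Resp n m) (i : Fin n) : ℝ≥0∞ :=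
  ∫⁻ θ in S, M.cvLik x b D i θ ∂M.prior

/-- The `S`-restricted inverse cross-validation posterior of `x̃_i` given `(X_{n,-i}, Y_nm)`. -/
def cvPost (x : ℕ → ℝ) (b : ℝ) (S : Set Θ) {n m : ℕ} (D : Resp n m) (i : Fin n) : Measure ℝ :=
  volume.withDensity fun z =>
    (∫⁻ θ in S, M.xPost b D i θ z * M.cvLik x b D i θ ∂M.prior) / M.cvNorm x b S D i

end InvModel

/-- The two kinds of discrepancy measures, `T₁` and `T₂`. -/
inductive Discrepancy where
  | absolute
  | squared

/-- The contribution to the discrepancy of a covariate value `v` with reference distribution `μ`. -/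
def Discrepancy.term : Discrepancy → ℝ → Measure ℝ → ℝ → ℝ
  | .absolute, c, μ, v => |v - ∫ z, z ∂μ| / √(variance id μ + c)
  | .squared, c, μ, v => (v - ∫ z, z ∂μ) ^ 2 / (variance id μ + c)

/-- The data of the model selection problem and of the multiple testing procedure for `K` models. -/
structure Selection {K : ℕ} (Θ : Fin K → Type*) [∀ k, MeasurableSpace (Θ k)] (𝒳 : Set ℝ)
    (ν : Measure ℝ) where
  /-- the competing models -/
  M : ∀ k, InvModel (Θ k) 𝒳 ν
  /-- the prior of the mixing probabilities `(p_1, …, p_K)` -/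
  mix : Measure (Fin K → ℝ)
  /-- the observed covariates -/
  x : ℕ → ℝ
  /-- the constant in the sets `B_im(θ)` -/
  b : ℝ
  /-- the regions `Θ̃_k` -/
  region : ∀ k, Set (Θ k)
  /-- the kind of discrepancy measure, and its constant -/
  T : Discrepancy
  c : ℝ
  /-- the end points of the credible intervals, as functions of the data -/
  lo : Fin K → ∀ n m, Resp n m → ℝ
  up : Fin K → ∀ n m, Resp n m → ℝ
  /-- the constants `a_k` and `ε` of the hypotheses -/
  a : Fin K → ℝ
  ε : ℝ
  /-- the penalizing constants `β_nm` -/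
  β : ℕ → ℕ → ℝ

namespace Selection

variable {K : ℕ} {Θ : Fin K → Type*} [∀ k, MeasurableSpace (Θ k)] {𝒳 : Set ℝ} {ν : Measure ℝ}
  (S : Selection Θ 𝒳 ν)

/-- The discrepancy measure `T^{(k)}(v_1, …, v_n)`, given the data. -/
def disc (k : Fin K) {n m : ℕ} (D : Resp n m) (v : Fin n → ℝ) : ℝ :=
  (1 / n) * ∑ i, S.T.term S.c ((S.M k).cvPost S.x S.b (S.region k) D i) (v i)

/-- The observed discrepancy `T^{(k)}(X_n)`. -/
def discObs (k : Fin K) {n m : ℕ} (D : Resp n m) : ℝ := S.disc k D fun i => S.x i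

/-- The law of `X̃_n` under model `k`: the `x̃_i` follow independently their restricted inverse
cross-validation posteriors. -/
def refLaw (k : Fin K) {n m : ℕ} (D : Resp n m) : Measure (Fin n → ℝ) :=
  Measure.pi fun i => (S.M k).cvPost S.x S.b (S.region k) D i

/-- The event `T^{(k)}(X̃_n) - T^{(k)}(X_n) ∈ [ℓ - a_k - ε, u - a_k + ε]`. -/
def fit (k : Fin K) {n m : ℕ} (D : Resp n m) : Set (Fin n → ℝ) :=
  {v | S.disc k D v - S.discObs k D ∈
    Icc (S.lo k n m D - S.a k - S.ε) (S.up k n m D - S.a k + S.ε)}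

/-- The prior probability of `ζ = k`, the mean of `p_k`. -/
def weight (k : Fin K) : ℝ≥0∞ := ∫⁻ p, ENNReal.ofReal (p k) ∂S.mix

/-- The posterior probability of `ζ = k` in the mixture of the competing models. -/
def postModel (k : Fin K) {n m : ℕ} (D : Resp n m) : ℝ≥0∞ :=
  S.weight k * (S.M k).marg S.x D / ∑ l, S.weight l * (S.M l).marg S.x D

/-- `v_knm`: the posterior probability of the alternative hypothesis `H_{1k}`, the sum of those of
`ζ ≠ k`, of `ζ = k` and `θ_k ∉ Θ̃_k`, and of `ζ = k`, `θ_k ∈ Θ̃_k` and the failure of the fit. -/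
def v (k : Fin K) {n m : ℕ} (D : Resp n m) : ℝ :=
  ((∑ l ∈ Finset.univ.erase k, S.postModel l D)
    + S.postModel k D * (S.M k).post S.x D (S.region k)ᶜ
    + S.postModel k D * (S.M k).post S.x D (S.region k) * S.refLaw k D (S.fit k D)ᶜ).toReal

open Classical in
/-- The optimal decision configuration: the `k`-th hypothesis is rejected if `v_knm > β_nm`. -/
def dHat {n m : ℕ} (D : Resp n m) (k : Fin K) : Fin 2 := if S.β n m < S.v k D then 1 else 0

open Classical in
/-- `δ(d | X_n, Y_nm)`: whether `d` is the optimal decision configuration. -/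
def delta {n m : ℕ} (D : Resp n m) (d : Fin K → Fin 2) : ℝ := if d = S.dHat D then 1 else 0

/-- The conditional false non-discovery rate `cFNR_nm`. -/
def cFNR {n m : ℕ} (D : Resp n m) : ℝ :=
  ∑ d : Fin K → Fin 2,
    (∑ k, (1 - ((d k : ℕ) : ℝ)) * S.v k D) / max (∑ k, (1 - ((d k : ℕ) : ℝ))) 1 * S.delta D d

/-- The positive Bayesian false non-discovery rate `pBFNR_nm`: the expectation of `cFNR_nm` over the
distribution of `Y_nm` given `X_n` under the true model. -/
def pBFNR {Θ₀ : Type*} [MeasurableSpace Θ₀] (M₀ : RespModel Θ₀ 𝒳 ν) (n m : ℕ) : ℝ≥0∞ :=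
  ∫⁻ D : Resp n m, ENNReal.ofReal (S.cFNR D) ∂M₀.law S.x n m

end Selection

end

/-! For fixed `m`, the integral of the likelihood ratio against the prior over a set `A` decays like
`exp(-n h(A))`, up to arbitrarily small changes of the exponent. The upper bound (`Shalizi.upper`)
splits `A` along the sieve: off the sieve the expected ratio is at most the prior mass, which is
exponentially small, so Borel-Cantelli applies; on the sieve, uniform convergence and (S6) apply.
The upper exponent must also stay below `γ`, which exceeds `h(Θ)`. The lower bound (`Shalizi.lower`)
integrates only over sieve parameters of nearly minimal divergence. Quotients of such integrals show
that the complement of the region of the best model loses its posterior mass and that each other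
model loses its posterior probability.

The last part of `v` for the best model is handled by a law of large numbers. The reference
discrepancy averages bounded functions of independent coordinates, so it concentrates near a
constant. A credible interval of fixed positive level must come close to that constant, and the
slack `ε` then makes it capture nearly all mass once the observed discrepancy is near `a`
(`Selection.tendsto_refLaw_fit_compl`).

Hence `v` tends to zero for the best model, while for every other model it is at least the posterior
probability of the best one, which tends to one. Thresholds bounded away from zero and one then
leave exactly the best hypothesis unrejected, and `cFNR` equals its `v`. Boundedness carries the
almost sure limit over to expectations (`tendsto_curry_lintegral`). -/

/-! ### Densities of the responses: measurability and total mass. -/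

/-- Tonelli's theorem for a product of functions of the single coordinates. -/
theorem lintegral_fin_prod_eq_prod {n : ℕ} {E : Type*} [MeasurableSpace E] (μ : Measure E)
    [SigmaFinite μ] (f : Fin n → E → ℝ≥0∞) (hf : ∀ i, Measurable (f i)) :
    ∫⁻ x, ∏ i, f i (x i) ∂(Measure.pi fun _ : Fin n => μ) = ∏ i, ∫⁻ x, f i x ∂μ := by
  induction n with
  | zero => simp
  | succ n ih =>
    have hmp := measurePreserving_piFinSuccAbove (fun _ : Fin (n + 1) => μ) 0
    rw [← (hmp.symm _).lintegral_comp_emb (MeasurableEquiv.measurableEmbedding _)]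
    simp_rw [MeasurableEquiv.piFinSuccAbove_symm_apply, Fin.insertNthEquiv,
      Fin.prod_univ_succ, Fin.insertNth_zero, Equiv.coe_fn_mk, Fin.cons_succ, Fin.cons_zero]
    simp only [cast_eq]
    rw [lintegral_prod_mul (f := f 0) (g := fun w : Fin n → E => ∏ i : Fin n, f i.succ (w i)),
      ih _ fun i => hf i.succ]
    · exact (hf 0).aemeasurable
    · exact (Finset.measurable_prod _ fun i _ =>
        (hf i.succ).comp (measurable_pi_apply i)).aemeasurable

theorem measurable_hist {n m : ℕ} (i : Fin n) (j : Fin m) :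
    Measurable fun D : Resp n m => hist D i j := by
  unfold hist
  fun_prop

namespace RespModel

variable {Θ : Type*} [MeasurableSpace Θ] {𝒳 : Set ℝ} {ν : Measure ℝ} (M : RespModel Θ 𝒳 ν)

theorem measurable_block {n m : ℕ} (i : Fin n) :
    Measurable fun p : Θ × Resp n m × ℝ => M.block p.2.1 p.1 i p.2.2 := by
  unfold block
  refine Finset.measurable_prod _ fun j _ => ?_
  have h : Measurable fun p : Θ × Resp n m × ℝ =>
      (p.1, p.2.2, hist p.2.1 i j, p.2.1 i j) := by
    refine measurable_fst.prodMk ((measurable_snd.comp measurable_snd).prodMk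
      (((measurable_hist i j).comp (measurable_fst.comp measurable_snd)).prodMk ?_))
    fun_prop
  exact ((M.dens_meas i).comp h).coe_nnreal_ennreal

theorem measurable_lik (x : ℕ → ℝ) {n m : ℕ} :
    Measurable fun p : Θ × Resp n m => M.lik x p.1 p.2 := by
  unfold lik
  refine Finset.measurable_prod _ fun i _ => ?_
  exact (M.measurable_block i).comp
    (measurable_fst.prodMk (measurable_snd.prodMk measurable_const))

theorem measurable_marg (x : ℕ → ℝ) {n m : ℕ} : Measurable fun D : Resp n m => M.marg x D := by
  have := M.prior_prob
  exact (M.measurable_lik x).lintegral_prod_left'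

/-- The density of the responses given the parameter integrates to one. -/
theorem lintegral_lik [SigmaFinite ν] {x : ℕ → ℝ} (hx : ∀ i, x i ∈ 𝒳) (n m : ℕ) (θ : Θ) :
    ∫⁻ D : Resp n m, M.lik x θ D ∂(Measure.pi fun _ => Measure.pi fun _ => ν) = 1 := by
  induction n with
  | zero => simp [lik]
  | succ n ih =>
    -- The last block is split off because no earlier density has it in its history.
    have hmp := measurePreserving_piFinSuccAbove
      (fun _ : Fin (n + 1) => Measure.pi fun _ : Fin m => ν) (Fin.last n)
    rw [← (hmp.symm _).lintegral_comp_emb (MeasurableEquiv.measurableEmbedding _)]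
    have hsplit : ∀ (u : Fin m → ℝ) (D : Resp n m),
        M.lik x θ ((MeasurableEquiv.piFinSuccAbove (fun _ => Fin m → ℝ) (Fin.last n)).symm (u, D))
          = M.lik x θ D * ∏ j, (M.dens n θ (x n) (fun r => D r j) (u j) : ℝ≥0∞) := by
      intro u D
      have he : (MeasurableEquiv.piFinSuccAbove (fun _ => Fin m → ℝ) (Fin.last n)).symm (u, D)
          = (Fin.snoc D u : Resp (n + 1) m) := by
        rw [MeasurableEquiv.piFinSuccAbove_symm_apply]
        exact Fin.insertNth_last' (β := Fin m → ℝ) u D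
      rw [he]
      unfold lik
      rw [Fin.prod_univ_castSucc]
      congr 1
      · refine Finset.prod_congr rfl fun i _ => ?_
        unfold block
        refine Finset.prod_congr rfl fun j _ => ?_
        have h1 : hist (Fin.snoc D u : Resp (n + 1) m) i.castSucc j = hist D i j := by
          funext r
          exact congrFun (Fin.snoc_castSucc (α := fun _ => Fin m → ℝ) u D
            (⟨r, r.2.trans i.2⟩ : Fin n)) j
        have h2 : (Fin.snoc D u : Resp (n + 1) m) i.castSucc = D i :=
          Fin.snoc_castSucc (α := fun _ => Fin m → ℝ) u D i
        rw [h1, h2]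
        rfl
      · unfold block
        refine Finset.prod_congr rfl fun j _ => ?_
        have h1 : hist (Fin.snoc D u : Resp (n + 1) m) (Fin.last n) j = fun r => D r j := by
          funext r
          exact congrFun (Fin.snoc_castSucc (α := fun _ => Fin m → ℝ) u D r) j
        have h2 : (Fin.snoc D u : Resp (n + 1) m) (Fin.last n) = u :=
          Fin.snoc_last (α := fun _ => Fin m → ℝ) u D
        rw [h1, h2]
        rfl
    have hmeas : Measurable fun p : (Fin m → ℝ) × Resp n m =>
        M.lik x θ ((MeasurableEquiv.piFinSuccAbove (fun _ => Fin m → ℝ) (Fin.last n)).symm p) :=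
      (M.measurable_lik x).comp (measurable_const.prodMk (MeasurableEquiv.measurable _))
    -- The last block is integrated first, with its history frozen; each conditional density then
    -- contributes a factor one.
    rw [lintegral_prod_symm' _ hmeas]
    simp_rw [hsplit]
    rw [← ih]
    refine lintegral_congr fun D => ?_
    have hd : ∀ j : Fin m, Measurable fun u : ℝ =>
        (M.dens n θ (x n) (fun r => D r j) u : ℝ≥0∞) := fun j =>
      ((M.dens_meas n).comp (measurable_const.prodMk (measurable_const.prodMk
        (measurable_const.prodMk measurable_id)))).coe_nnreal_ennreal
    rw [lintegral_const_mul]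
    · rw [lintegral_fin_prod_eq_prod ν
        (fun j u => (M.dens n θ (x n) (fun r => D r j) u : ℝ≥0∞)) hd]
      simp [M.dens_prob n θ (x n) (hx n)]
    · exact Finset.measurable_prod _ fun j _ => (hd j).comp (measurable_pi_apply j)

end RespModel

/-! ### Exponential bounds and Borel-Cantelli. -/

theorem ENNReal.log_ofReal_exp (r : ℝ) : ENNReal.log (ENNReal.ofReal (Real.exp r)) = (r : EReal) := by
  rw [ENNReal.log_ofReal_of_pos (Real.exp_pos r), Real.log_exp]

theorem ENNReal.log_div_le_iff {a : ℝ≥0∞} {n : ℕ} (hn : 0 < n) (r : ℝ) :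
    ENNReal.log a / (n : EReal) ≤ (r : EReal) ↔ a ≤ ENNReal.ofReal (Real.exp (r * n)) := by
  rw [EReal.div_le_iff_le_mul (by exact_mod_cast hn) (EReal.natCast_ne_top n),
    ← ENNReal.log_le_log_iff, ENNReal.log_ofReal_exp, mul_comm]
  push_cast
  rfl

theorem ENNReal.le_log_div_iff {a : ℝ≥0∞} {n : ℕ} (hn : 0 < n) (r : ℝ) :
    (r : EReal) ≤ ENNReal.log a / (n : EReal) ↔ ENNReal.ofReal (Real.exp (r * n)) ≤ a := by
  rw [EReal.le_div_iff_mul_le (by exact_mod_cast hn) (EReal.natCast_ne_top n),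
    ← ENNReal.log_le_log_iff, ENNReal.log_ofReal_exp]
  push_cast
  rfl

theorem ENNReal.tendsto_ofReal_exp_neg_mul {s : ℝ} (hs : 0 < s) :
    Tendsto (fun n : ℕ => ENNReal.ofReal (Real.exp (-s * n))) atTop (𝓝 0) := by
  rw [← ENNReal.ofReal_zero]
  exact ENNReal.tendsto_ofReal (Real.tendsto_exp_atBot.comp
    (tendsto_natCast_atTop_atTop.const_mul_atTop_of_neg (by linarith)))

/-- Random variables with exponentially small expectations are almost surely eventually
exponentially small. -/
theorem ae_eventually_le_exp {Ω : Type*} [MeasurableSpace Ω] {P : Measure Ω}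
    {f : ℕ → Ω → ℝ≥0∞} (hf : ∀ n, Measurable (f n)) {C γ r : ℝ} (hr : r < γ)
    (hint : ∀ n : ℕ, ∫⁻ ω, f n ω ∂P ≤ ENNReal.ofReal (C * Real.exp (-γ * n))) :
    ∀ᵐ ω ∂P, ∀ᶠ n : ℕ in atTop, f n ω ≤ ENNReal.ofReal (Real.exp (-r * n)) := by
  -- Markov's inequality bounds these probabilities by a geometric series of ratio `exp(-(γ - r))`;
  -- `|C|` appears because no sign of `C` is assumed.
  have hsum : ∑' n : ℕ, P {ω | ENNReal.ofReal (Real.exp (-r * n)) ≤ f n ω} ≠ ∞ := by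
    have hb : ∀ n : ℕ, P {ω | ENNReal.ofReal (Real.exp (-r * n)) ≤ f n ω}
        ≤ ENNReal.ofReal (|C| * Real.exp (-(γ - r)) ^ n) := by
      intro n
      have h := (mul_meas_ge_le_lintegral (μ := P) (hf n)
        (ENNReal.ofReal (Real.exp (-r * n)))).trans (hint n)
      have he : C * Real.exp (-γ * n)
          = Real.exp (-r * n) * (C * Real.exp (-(γ - r)) ^ n) := by
        rw [← Real.exp_nat_mul, mul_left_comm, ← Real.exp_add]
        ring_nf
      rw [he, ENNReal.ofReal_mul (Real.exp_pos _).le] at h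
      refine ((ENNReal.mul_le_mul_iff_right ?_ ENNReal.ofReal_ne_top).1 h).trans ?_
      · simp [Real.exp_pos]
      · exact ENNReal.ofReal_le_ofReal
          (mul_le_mul_of_nonneg_right (le_abs_self C) (by positivity))
    refine ne_top_of_le_ne_top ?_ (ENNReal.tsum_le_tsum hb)
    have hs : Summable fun n : ℕ => |C| * Real.exp (-(γ - r)) ^ n :=
      (summable_geometric_of_lt_one (Real.exp_pos _).le
        (Real.exp_lt_one_iff.2 (by linarith))).mul_left _
    rw [← ENNReal.ofReal_tsum_of_nonneg (fun n => by positivity) hs]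
    exact ENNReal.ofReal_ne_top
  filter_upwards [ae_eventually_notMem hsum] with ω hω
  filter_upwards [hω] with n hn
  exact (not_le.1 hn).le

theorem measurable_obs {Ω : Type*} [MeasurableSpace Ω] {y : ℕ → ℕ → Ω → ℝ}
    (hy : ∀ i j, Measurable (y i j)) (n m : ℕ) : Measurable (obs y n m) :=
  measurable_pi_lambda _ fun i => measurable_pi_lambda _ fun j => hy i j

/-! ### Two-sided exponential bounds for integrated likelihood ratios. -/

section Ratio

variable {Θ Θ₀ Ω : Type*} [MeasurableSpace Θ] [MeasurableSpace Θ₀]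
  {𝒳 : Set ℝ} {ν : Measure ℝ} {M : RespModel Θ 𝒳 ν} {M₀ : RespModel Θ₀ 𝒳 ν} {x : ℕ → ℝ}
  {y : ℕ → ℕ → Ω → ℝ}

/-- Uniform convergence of the log likelihood ratio bounds the integrated likelihood ratio. -/
theorem RespModel.logInt_le_of_uniform [IsProbabilityMeasure M.prior] {m : ℕ} {ω : Ω} {G A : Set Θ}
    (hfin : ∀ δ : ℝ, 0 < δ → ∀ᶠ n : ℕ in atTop, ∀ θ ∈ G, M.klRate M₀ x m θ ≠ ∞ →
      ENNReal.log (M.ratio M₀ x θ (obs y n m ω)) / (n : EReal) ≤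
          -(M.klRate M₀ x m θ : EReal) + (δ : EReal))
    (hinf : ∀ B : ℝ, ∀ᶠ n : ℕ in atTop, ∀ θ ∈ G, M.klRate M₀ x m θ = ∞ →
      ENNReal.log (M.ratio M₀ x θ (obs y n m ω)) / (n : EReal) ≤ (B : EReal))
    (hGA : MeasurableSet (G ∩ A)) {r : ℝ} (hr : (r : EReal) < M.klInf M₀ x m (G ∩ A)) :
    ∀ᶠ n : ℕ in atTop, M.logInt M₀ x (G ∩ A) (obs y n m ω) ≤ ((-r : ℝ) : EReal) := by
  -- The gap `s - r` pays for the uniform error where the rate is finite.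
  obtain ⟨s, hrs, hs⟩ := EReal.lt_iff_exists_real_btwn.1 hr
  rw [EReal.coe_lt_coe_iff] at hrs
  have hae : ∀ᵐ θ ∂M.prior.restrict (G ∩ A), (s : EReal) < M.klRate M₀ x m θ := by
    filter_upwards [ae_essInf_le (f := M.klRate M₀ x m) (μ := M.prior.restrict (G ∩ A))] with θ hθ
    exact hs.trans_le (EReal.coe_ennreal_le_coe_ennreal_iff.2 hθ)
  filter_upwards [hfin (s - r) (by linarith), hinf (-r), eventually_gt_atTop 0] with n h1 h2 hn
  rw [logInt, ENNReal.log_div_le_iff hn]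
  have hb : ∀ᵐ θ ∂M.prior.restrict (G ∩ A),
      M.ratio M₀ x θ (obs y n m ω) ≤ ENNReal.ofReal (Real.exp (-r * n)) := by
    filter_upwards [hae, ae_restrict_mem hGA] with θ hθ hθG
    rw [← ENNReal.log_div_le_iff hn]
    by_cases ht : M.klRate M₀ x m θ = ∞
    · exact h2 θ hθG.1 ht
    · refine (h1 θ hθG.1 ht).trans ?_
      lift M.klRate M₀ x m θ to ℝ≥0 using ht with t
      rw [EReal.coe_nnreal_eq_coe_real] at hθ ⊢
      rw [EReal.coe_lt_coe_iff] at hθ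
      norm_cast
      linarith
  calc
    _ ≤ ∫⁻ _ in G ∩ A, ENNReal.ofReal (Real.exp (-r * n)) ∂M.prior := lintegral_mono_ae hb
    _ ≤ ENNReal.ofReal (Real.exp (-r * n)) := by
      rw [setLIntegral_const]
      exact mul_le_of_le_one_right' prob_le_one

variable [MeasurableSpace Ω] {P : Measure Ω}

theorem RespModel.measurable_ratio {n m : ℕ} :
    Measurable fun p : Θ × Resp n m => M.ratio M₀ x p.1 p.2 :=
  (M.measurable_lik x).div ((M₀.measurable_marg x).comp measurable_snd)

/-- The true marginal density of the responses is almost surely positive and finite. -/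
theorem RespModel.ae_marg_ne [SigmaFinite ν] (hx : ∀ i, x i ∈ 𝒳)
    (hy : ∀ i j, Measurable (y i j)) {n m : ℕ} (hlaw : P.map (obs y n m) = M₀.law x n m) :
    ∀ᵐ ω ∂P, M₀.marg x (obs y n m ω) ≠ 0 ∧ M₀.marg x (obs y n m ω) ≠ ∞ := by
  refine ae_of_ae_map (measurable_obs hy n m).aemeasurable
    (p := fun D => M₀.marg x D ≠ 0 ∧ M₀.marg x D ≠ ∞) ?_
  rw [hlaw, law, ae_withDensity_iff (M₀.measurable_marg x)]
  have hint : ∫⁻ D : Resp n m, M₀.marg x D ∂(Measure.pi fun _ => Measure.pi fun _ => ν) ≠ ∞ := by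
    have := M₀.prior_prob
    unfold marg
    rw [lintegral_lintegral_swap]
    · simp_rw [M₀.lintegral_lik hx]
      simp
    · exact ((M₀.measurable_lik x).comp measurable_swap).aemeasurable
  filter_upwards [ae_lt_top (M₀.measurable_marg x) hint] with D hD h0
  exact ⟨h0, hD.ne⟩

theorem RespModel.measurable_setLIntegral_ratio (A : Set Θ) {n m : ℕ} :
    Measurable fun D : Resp n m => ∫⁻ θ in A, M.ratio M₀ x θ D ∂M.prior := by
  have := M.prior_prob
  exact (RespModel.measurable_ratio (M := M) (M₀ := M₀) (x := x)).lintegral_prod_left'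

/-- The expected likelihood ratio is at most one. -/
theorem RespModel.lintegral_ratio_le [SigmaFinite ν] (hx : ∀ i, x i ∈ 𝒳)
    (hy : ∀ i j, Measurable (y i j)) {n m : ℕ} (hlaw : P.map (obs y n m) = M₀.law x n m)
    (A : Set Θ) :
    ∫⁻ ω, ∫⁻ θ in A, M.ratio M₀ x θ (obs y n m ω) ∂M.prior ∂P ≤ M.prior A := by
  have := M.prior_prob
  have hm := RespModel.measurable_setLIntegral_ratio (M := M) (M₀ := M₀) (x := x) A (n := n) (m := m)
  -- Only an inequality: multiplying the quotient back may lose mass where the true marginal density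
  -- is `0` or `∞`.
  have hle : ∀ D : Resp n m, M₀.marg x D * ∫⁻ θ in A, M.ratio M₀ x θ D ∂M.prior
      ≤ ∫⁻ θ in A, M.lik x θ D ∂M.prior := by
    intro D
    have hl : Measurable fun θ => M.lik x θ D :=
      (M.measurable_lik x).comp (measurable_id.prodMk measurable_const)
    have hmθ : Measurable fun θ => M.ratio M₀ x θ D := hl.div_const _
    rw [← lintegral_const_mul _ hmθ]
    refine lintegral_mono fun θ => ?_
    rw [ratio]
    exact ENNReal.mul_div_le
  have hswap : ∫⁻ D : Resp n m, ∫⁻ θ in A, M.lik x θ D ∂M.prior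
      ∂(Measure.pi fun _ => Measure.pi fun _ => ν) = M.prior A := by
    rw [lintegral_lintegral_swap]
    · simp_rw [M.lintegral_lik hx]
      simp
    · exact ((M.measurable_lik x).comp measurable_swap).aemeasurable
  calc
    _ = ∫⁻ D, ∫⁻ θ in A, M.ratio M₀ x θ D ∂M.prior ∂M₀.law x n m := by
        rw [← hlaw, lintegral_map hm (measurable_obs hy n m)]
    _ = ∫⁻ D : Resp n m, M₀.marg x D * ∫⁻ θ in A, M.ratio M₀ x θ D ∂M.prior
          ∂(Measure.pi fun _ => Measure.pi fun _ => ν) :=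
        lintegral_withDensity_eq_lintegral_mul _ (M₀.measurable_marg x) hm
    _ ≤ _ := lintegral_mono hle
    _ = M.prior A := hswap

/-- Shalizi's upper bound for the integrated likelihood ratio. -/
theorem Shalizi.upper [SigmaFinite ν] {m : ℕ} (hS : Shalizi M M₀ x P y m) (hx : ∀ i, x i ∈ 𝒳)
    (hy : ∀ i j, Measurable (y i j)) (hlaw : ∀ n, P.map (obs y n m) = M₀.law x n m) :
    ∃ γ : ℝ, 2 * M.klInf M₀ x m univ < ENNReal.ofReal γ ∧
      ∀ A, MeasurableSet A → ∀ r : ℝ, r < γ → (r : EReal) < M.klInf M₀ x m A →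
        ∀ᵐ ω ∂P, ∀ᶠ n : ℕ in atTop,
          ∫⁻ θ in A, M.ratio M₀ x θ (obs y n m ω) ∂M.prior ≤
            ENNReal.ofReal (Real.exp (-r * n)) := by
  have := M.prior_prob
  obtain ⟨G, hG, -, ⟨C, γ, -, hγ, hGC⟩, hunif, hinf, -, hs6, hs7⟩ := hS.s567
  refine ⟨γ, hγ, fun A hA r hrγ hrA => ?_⟩
  -- (S6) and (S7) speak only of sets of positive prior mass.
  rcases eq_or_ne (M.prior A) 0 with h0 | h0
  · refine ae_of_all _ fun ω => Eventually.of_forall fun n => ?_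
    rw [setLIntegral_measure_zero _ _ h0]
    exact zero_le
  -- The exponents satisfy `r < r₁ < r₂ < h(A)` and `r₁ < γ`: the last inequality serves
  -- Borel-Cantelli off the sieve, the gap `r₂ - r₁` absorbs `δ`, and the gap `r₁ - r` absorbs a
  -- final factor two.
  obtain ⟨r₁, hr₁, hr₁'⟩ := EReal.lt_iff_exists_real_btwn.1
    (lt_min hrA (EReal.coe_lt_coe_iff.2 hrγ))
  obtain ⟨r₂, hr₂, hr₂'⟩ := EReal.lt_iff_exists_real_btwn.1 (lt_min_iff.1 hr₁').1
  have hr₁γ : r₁ < γ := EReal.coe_lt_coe_iff.1 (lt_min_iff.1 hr₁').2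
  rw [EReal.coe_lt_coe_iff] at hr₁ hr₂
  have hcompl : ∀ᵐ ω ∂P, ∀ᶠ n : ℕ in atTop,
      ∫⁻ θ in (G n)ᶜ, M.ratio M₀ x θ (obs y n m ω) ∂M.prior ≤
        ENNReal.ofReal (Real.exp (-r₁ * n)) := by
    refine ae_eventually_le_exp (C := C) (γ := γ)
      (fun n => (RespModel.measurable_setLIntegral_ratio _).comp (measurable_obs hy n m))
      hr₁γ fun n => ?_
    refine (RespModel.lintegral_ratio_le hx hy (hlaw n) _).trans ?_
    rw [← ofReal_measureReal, probReal_compl_eq_one_sub (hG n)]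
    exact ENNReal.ofReal_le_ofReal (by linarith [hGC n])
  -- Taking `δ ≤ 1 / (|r₁| + 1)` makes the alternative `-1/δ` in (S6) harmless, since then `δ - 1/δ
  -- ≤ 1 - (|r₁| + 1) ≤ -r₁`.
  obtain ⟨δ, hδ, hδ₁, hδ₂⟩ : ∃ δ : ℝ, 0 < δ ∧ δ ≤ r₂ - r₁ ∧ δ + -δ⁻¹ ≤ -r₁ := by
    have hp : 0 < |r₁| + 1 := by positivity
    refine ⟨min (r₂ - r₁) (|r₁| + 1)⁻¹, lt_min (by linarith) (by positivity), min_le_left _ _, ?_⟩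
    have h1 : min (r₂ - r₁) (|r₁| + 1)⁻¹ ≤ (|r₁| + 1)⁻¹ := min_le_right _ _
    have h2 : |r₁| + 1 ≤ (min (r₂ - r₁) (|r₁| + 1)⁻¹)⁻¹ :=
      (le_inv_comm₀ hp (lt_min (by linarith) (by positivity))).2 h1
    have h3 : (|r₁| + 1)⁻¹ ≤ 1 := inv_le_one_of_one_le₀ (by linarith [abs_nonneg r₁])
    linarith [le_abs_self r₁]
  have hklA : ∀ᶠ n in atTop, (r₂ : EReal) < M.klInf M₀ x m (G n ∩ A) :=
    ((continuous_coe_ennreal_ereal.tendsto _).comp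
      (hs7 A hA (pos_iff_ne_zero.2 h0))).eventually_const_lt hr₂'
  have htwo : ∀ᶠ n : ℕ in atTop, 2 * Real.exp (-r₁ * n) ≤ Real.exp (-r * n) := by
    have ht : Tendsto (fun n : ℕ => (r₁ - r) * (n : ℝ)) atTop atTop :=
      tendsto_natCast_atTop_atTop.const_mul_atTop (by linarith)
    filter_upwards [ht.eventually_ge_atTop (Real.log 2)] with n hn
    rw [← Real.exp_log (two_pos : (0 : ℝ) < 2), ← Real.exp_add]
    exact Real.exp_le_exp.2 (by linarith)
  filter_upwards [hcompl, hs6 A hA (pos_iff_ne_zero.2 h0) δ hδ, ae_all_iff.2 hunif,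
    ae_all_iff.2 hinf] with ω hc h6 hu hi
  filter_upwards [hc, h6, hklA, htwo, eventually_gt_atTop 0] with n hcn h6n hkn h2n hn
  -- The sieve index `n` is frozen while the sample size `s` grows; (S6) at `t = n` then brings the
  -- bound back to the diagonal.
  have hlim : limsup (fun s => M.logInt M₀ x (G n ∩ A) (obs y s m ω)) atTop
      ≤ ((-r₂ : ℝ) : EReal) :=
    limsup_le_of_le (by isBoundedDefault) (RespModel.logInt_le_of_uniform
      (fun δ hδ => (hu n δ hδ).mono fun s hs θ hθ ht => (hs θ hθ ht).2) (hi n)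
      ((hG n).inter hA) hkn)
  have hle : M.logInt M₀ x (G n ∩ A) (obs y n m ω) ≤ ((-r₁ : ℝ) : EReal) := by
    refine (h6n n le_rfl).trans ((add_le_add_right (max_le_max hlim le_rfl) _).trans ?_)
    rw [← max_add_add_left]
    refine max_le ?_ (by exact_mod_cast hδ₂)
    norm_cast
    linarith
  rw [RespModel.logInt, ENNReal.log_div_le_iff hn] at hle
  calc
    _ ≤ ∫⁻ θ in (G n ∩ A) ∪ (G n)ᶜ, M.ratio M₀ x θ (obs y n m ω) ∂M.prior :=
      lintegral_mono_set fun θ hθ => by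
        by_cases h : θ ∈ G n
        exacts [Or.inl ⟨h, hθ⟩, Or.inr h]
    _ ≤ _ := lintegral_union_le _ _ _
    _ ≤ ENNReal.ofReal (Real.exp (-r₁ * n)) + ENNReal.ofReal (Real.exp (-r₁ * n)) :=
      add_le_add hle hcn
    _ = ENNReal.ofReal (2 * Real.exp (-r₁ * n)) := by
      rw [← ENNReal.ofReal_add (Real.exp_pos _).le (Real.exp_pos _).le, two_mul]
    _ ≤ _ := ENNReal.ofReal_le_ofReal h2n

/-- Shalizi's lower bound for the integrated likelihood ratio. -/
theorem Shalizi.lower {m : ℕ} (hS : Shalizi M M₀ x P y m) {r : ℝ}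
    (hr : (M.klInf M₀ x m univ : EReal) < r) :
    ∀ᵐ ω ∂P, ∀ᶠ n : ℕ in atTop, ENNReal.ofReal (Real.exp (-r * n)) ≤
      ∫⁻ θ, M.ratio M₀ x θ (obs y n m ω) ∂M.prior := by
  have := M.prior_prob
  obtain ⟨G, hG, -, -, hunif, -, hlim, -, -⟩ := hS.s567
  obtain ⟨c, hc, hcr⟩ := EReal.lt_iff_exists_real_btwn.1 hr
  rw [EReal.coe_lt_coe_iff] at hcr
  -- One sieve set with divergence below `c` suffices: by the definition of the essential infimum
  -- its part of rate below `c` has positive prior mass. Half of `r - c` will absorb that fixed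
  -- mass, the other half the uniform error.
  obtain ⟨N, hN⟩ := (((continuous_coe_ennreal_ereal.tendsto _).comp hlim).eventually_lt_const
    hc).exists
  have hBm : MeasurableSet {θ | (M.klRate M₀ x m θ : EReal) < c} :=
    measurableSet_lt (measurable_coe_ennreal_ereal.comp hS.s2_meas) measurable_const
  set B : Set Θ := G N ∩ {θ | (M.klRate M₀ x m θ : EReal) < c} with hB
  have hBpos : M.prior B ≠ 0 := by
    intro h0
    refine absurd hN (not_lt.2 ?_)
    have hae : ∀ᵐ θ ∂M.prior.restrict (G N), ENNReal.ofReal c ≤ M.klRate M₀ x m θ := by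
      rw [ae_restrict_iff' (hG N)]
      filter_upwards [measure_eq_zero_iff_ae_notMem.1 h0] with θ hθ hθG
      have h1 : (c : EReal) ≤ M.klRate M₀ x m θ := not_lt.1 fun h => hθ ⟨hθG, h⟩
      rcases le_or_gt c 0 with hc0 | hc0
      · rw [ENNReal.ofReal_of_nonpos hc0]; exact zero_le
      · rw [← EReal.coe_ennreal_le_coe_ennreal_iff, EReal.coe_ennreal_ofReal, max_eq_left hc0.le]
        exact h1
    have h2 : ENNReal.ofReal c ≤ M.klInf M₀ x m (G N) := le_essInf_of_ae_le _ hae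
    refine le_trans ?_ (EReal.coe_ennreal_le_coe_ennreal_iff.2 h2)
    rw [EReal.coe_ennreal_ofReal]
    exact_mod_cast le_max_left _ _
  have hsmall : ∀ᶠ n : ℕ in atTop, ENNReal.ofReal (Real.exp (-((r - c) / 2) * n)) ≤ M.prior B := by
    have ht := ENNReal.tendsto_ofReal_exp_neg_mul (s := (r - c) / 2) (by linarith)
    exact (ht.eventually_lt_const (pos_iff_ne_zero.2 hBpos)).mono fun n hn => hn.le
  filter_upwards [hunif N] with ω hu
  filter_upwards [hu ((r - c) / 2) (by linarith), hsmall, eventually_gt_atTop 0] with n hn hs hn0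
  calc
    ENNReal.ofReal (Real.exp (-r * n))
      = ENNReal.ofReal (Real.exp ((-c - (r - c) / 2) * n))
          * ENNReal.ofReal (Real.exp (-((r - c) / 2) * n)) := by
        rw [← ENNReal.ofReal_mul (Real.exp_pos _).le, ← Real.exp_add]
        ring_nf
    _ ≤ ENNReal.ofReal (Real.exp ((-c - (r - c) / 2) * n)) * M.prior B := mul_le_mul_right hs _
    _ = ∫⁻ _ in B, ENNReal.ofReal (Real.exp ((-c - (r - c) / 2) * n)) ∂M.prior := by
        rw [setLIntegral_const]
    _ ≤ ∫⁻ θ in B, M.ratio M₀ x θ (obs y n m ω) ∂M.prior := by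
        refine lintegral_mono_ae ?_
        filter_upwards [ae_restrict_mem ((hG N).inter hBm)] with θ hθ
        rw [← ENNReal.le_log_div_iff hn0]
        have hlt : (M.klRate M₀ x m θ : EReal) < c := hθ.2
        have ht : M.klRate M₀ x m θ ≠ ∞ := by
          intro h
          rw [h] at hlt
          simp at hlt
        refine le_trans ?_ (hn θ hθ.1 ht).1
        lift M.klRate M₀ x m θ to ℝ≥0 using ht with t
        rw [EReal.coe_nnreal_eq_coe_real] at hlt ⊢
        rw [EReal.coe_lt_coe_iff] at hlt
        norm_cast
        linarith
    _ ≤ _ := setLIntegral_le_lintegral _ _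

end Ratio

/-! ### Posterior consistency and Bayes factors. -/

theorem EReal.coe_ennreal_lt_of_two_mul_lt {h : ℝ≥0∞} {γ : ℝ} (hγ : 2 * h < ENNReal.ofReal γ) :
    (h : EReal) < γ := by
  have h1 : h < ENNReal.ofReal γ :=
    (le_mul_of_one_le_left' one_le_two).trans_lt hγ
  have hpos : 0 < γ := ENNReal.ofReal_pos.1 (zero_le.trans_lt h1)
  rw [← EReal.coe_ennreal_lt_coe_ennreal_iff, EReal.coe_ennreal_ofReal, max_eq_left hpos.le] at h1
  exact h1

/-- A quotient of an exponentially smaller sequence by an exponentially larger one tends to zero. -/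
theorem ENNReal.tendsto_div_of_le_exp {a b : ℕ → ℝ≥0∞} {r s : ℝ} (hrs : r < s)
    (ha : ∀ᶠ n : ℕ in atTop, a n ≤ ENNReal.ofReal (Real.exp (-s * n)))
    (hb : ∀ᶠ n : ℕ in atTop, ENNReal.ofReal (Real.exp (-r * n)) ≤ b n) :
    Tendsto (fun n => a n / b n) atTop (𝓝 0) := by
  refine tendsto_of_tendsto_of_tendsto_of_le_of_le' tendsto_const_nhds
    (ENNReal.tendsto_ofReal_exp_neg_mul (sub_pos.2 hrs)) (Eventually.of_forall fun _ => zero_le) ?_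
  filter_upwards [ha, hb] with n han hbn
  refine (ENNReal.div_le_div han hbn).trans_eq ?_
  rw [← ENNReal.ofReal_div_of_pos (Real.exp_pos _), ← Real.exp_sub]
  ring_nf

section Consistency

variable {Θ Θ₀ Ω : Type*} [MeasurableSpace Θ] [MeasurableSpace Θ₀]
  {𝒳 : Set ℝ} {ν : Measure ℝ} {M : RespModel Θ 𝒳 ν} {M₀ : RespModel Θ₀ 𝒳 ν} {x : ℕ → ℝ}
  {y : ℕ → ℕ → Ω → ℝ}

theorem RespModel.setLIntegral_lik_eq {n m : ℕ} {D : Resp n m} (h0 : M₀.marg x D ≠ 0)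
    (ht : M₀.marg x D ≠ ∞) (A : Set Θ) :
    ∫⁻ θ in A, M.lik x θ D ∂M.prior
      = M₀.marg x D * ∫⁻ θ in A, M.ratio M₀ x θ D ∂M.prior := by
  have hl : Measurable fun θ => M.lik x θ D :=
    (M.measurable_lik x).comp (measurable_id.prodMk measurable_const)
  have hm : Measurable fun θ => M.ratio M₀ x θ D := hl.div_const _
  rw [← lintegral_const_mul _ hm]
  refine lintegral_congr fun θ => ?_
  rw [ratio, ENNReal.mul_div_cancel h0 ht]

theorem RespModel.marg_eq_mul {n m : ℕ} {D : Resp n m} (h0 : M₀.marg x D ≠ 0)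
    (ht : M₀.marg x D ≠ ∞) :
    M.marg x D = M₀.marg x D * ∫⁻ θ, M.ratio M₀ x θ D ∂M.prior := by
  have h := RespModel.setLIntegral_lik_eq (M := M) h0 ht univ
  rwa [Measure.restrict_univ] at h

variable [MeasurableSpace Ω] {P : Measure Ω} {m : ℕ}

/-- Room for an exponent strictly above `c` exists on both sides: `c` lies below `h(A)` by
assumption and below `γ` because `c ≤ h(Θ) < γ`. With `c` the infimum of the same model this gives
posterior consistency; with `c` that of a better model, the Bayes factor limit. -/
theorem Shalizi.exists_upper [SigmaFinite ν] (hS : Shalizi M M₀ x P y m) (hx : ∀ i, x i ∈ 𝒳)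
    (hy : ∀ i j, Measurable (y i j)) (hlaw : ∀ n, P.map (obs y n m) = M₀.law x n m)
    {A : Set Θ} (hA : MeasurableSet A) {c : ℝ≥0∞} (hcA : c < M.klInf M₀ x m A)
    (hc : c ≤ M.klInf M₀ x m univ) :
    ∃ s : ℝ, (c : EReal) < s ∧ ∀ᵐ ω ∂P, ∀ᶠ n : ℕ in atTop,
      ∫⁻ θ in A, M.ratio M₀ x θ (obs y n m ω) ∂M.prior ≤
        ENNReal.ofReal (Real.exp (-s * n)) := by
  obtain ⟨γ, hγ, hup⟩ := hS.upper hx hy hlaw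
  have h1 : (c : EReal) < min (M.klInf M₀ x m A : EReal) γ :=
    lt_min (EReal.coe_ennreal_lt_coe_ennreal_iff.2 hcA)
      ((EReal.coe_ennreal_le_coe_ennreal_iff.2 hc).trans_lt (EReal.coe_ennreal_lt_of_two_mul_lt hγ))
  obtain ⟨s, hcs, hs⟩ := EReal.lt_iff_exists_real_btwn.1 h1
  exact ⟨s, hcs, hup A hA s (EReal.coe_lt_coe_iff.1 (lt_min_iff.1 hs).2) (lt_min_iff.1 hs).1⟩

/-- The posterior probability of a set of larger divergence tends to zero. -/
theorem Shalizi.tendsto_post [SigmaFinite ν] (hS : Shalizi M M₀ x P y m) (hx : ∀ i, x i ∈ 𝒳)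
    (hy : ∀ i j, Measurable (y i j)) (hlaw : ∀ n, P.map (obs y n m) = M₀.law x n m)
    {A : Set Θ} (hA : MeasurableSet A) (hlt : M.klInf M₀ x m univ < M.klInf M₀ x m A) :
    ∀ᵐ ω ∂P, Tendsto (fun n => M.post x (obs y n m ω) A) atTop (𝓝 0) := by
  obtain ⟨s, hs, hup⟩ := hS.exists_upper hx hy hlaw hA hlt le_rfl
  obtain ⟨r, hr, hrs⟩ := EReal.lt_iff_exists_real_btwn.1 hs
  filter_upwards [hup, hS.lower hr, ae_all_iff.2 fun n => RespModel.ae_marg_ne hx hy (hlaw n)]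
    with ω hu hl h0
  refine (ENNReal.tendsto_div_of_le_exp (EReal.coe_lt_coe_iff.1 hrs) hu hl).congr fun n => ?_
  rw [RespModel.post, RespModel.setLIntegral_lik_eq (h0 n).1 (h0 n).2,
    RespModel.marg_eq_mul (M := M) (h0 n).1 (h0 n).2, ENNReal.mul_div_mul_left _ _ (h0 n).1 (h0 n).2]

/-- The Bayes factor against a model of smaller divergence tends to zero. -/
theorem Shalizi.tendsto_marg_div_marg [SigmaFinite ν] {Θ' : Type*} [MeasurableSpace Θ']
    {M' : RespModel Θ' 𝒳 ν} (hS : Shalizi M M₀ x P y m) (hS' : Shalizi M' M₀ x P y m)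
    (hx : ∀ i, x i ∈ 𝒳) (hy : ∀ i j, Measurable (y i j))
    (hlaw : ∀ n, P.map (obs y n m) = M₀.law x n m)
    (hlt : M.klInf M₀ x m univ < M'.klInf M₀ x m univ) :
    ∀ᵐ ω ∂P, Tendsto (fun n => M'.marg x (obs y n m ω) / M.marg x (obs y n m ω)) atTop (𝓝 0) := by
  obtain ⟨s, hs, hup⟩ := hS'.exists_upper hx hy hlaw MeasurableSet.univ hlt hlt.le
  obtain ⟨r, hr, hrs⟩ := EReal.lt_iff_exists_real_btwn.1 hs
  filter_upwards [hup, hS.lower hr, ae_all_iff.2 fun n => RespModel.ae_marg_ne hx hy (hlaw n)]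
    with ω hu hl h0
  simp_rw [Measure.restrict_univ] at hu
  refine (ENNReal.tendsto_div_of_le_exp (EReal.coe_lt_coe_iff.1 hrs) hu hl).congr fun n => ?_
  rw [RespModel.marg_eq_mul (M := M) (h0 n).1 (h0 n).2,
    RespModel.marg_eq_mul (M := M') (h0 n).1 (h0 n).2,
    ENNReal.mul_div_mul_left _ _ (h0 n).1 (h0 n).2]

/-- The marginal density under a competing model is eventually positive and finite. -/
theorem Shalizi.eventually_marg_ne [SigmaFinite ν] (hS : Shalizi M M₀ x P y m)
    (hx : ∀ i, x i ∈ 𝒳) (hy : ∀ i j, Measurable (y i j))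
    (hlaw : ∀ n, P.map (obs y n m) = M₀.law x n m) :
    ∀ᵐ ω ∂P, ∀ᶠ n in atTop, M.marg x (obs y n m ω) ≠ 0 ∧ M.marg x (obs y n m ω) ≠ ∞ := by
  obtain ⟨γ, hγ, hup⟩ := hS.upper hx hy hlaw
  have hγ' := EReal.coe_ennreal_lt_of_two_mul_lt hγ
  obtain ⟨r, hr, -⟩ := EReal.lt_iff_exists_real_btwn.1 hγ'
  have hγ0 : 0 < γ := by
    have h := (EReal.coe_ennreal_nonneg _).trans_lt hγ'
    exact_mod_cast h
  -- A negative exponent is always admissible in the upper bound; a growing bound is enough for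
  -- finiteness.
  have hneg : ((-1 : ℝ) : EReal) < M.klInf M₀ x m univ :=
    lt_of_lt_of_le (by norm_num) (EReal.coe_ennreal_nonneg _)
  filter_upwards [hup univ MeasurableSet.univ (-1) (by linarith) hneg, hS.lower hr,
    ae_all_iff.2 fun n => RespModel.ae_marg_ne hx hy (hlaw n)] with ω hu hl h0
  filter_upwards [hu, hl] with n hun hln
  rw [Measure.restrict_univ] at hun
  rw [RespModel.marg_eq_mul (h0 n).1 (h0 n).2]
  exact ⟨mul_ne_zero (h0 n).1
      (((ENNReal.ofReal_pos.2 (Real.exp_pos _)).trans_le hln).ne'),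
    ENNReal.mul_ne_top (h0 n).2 (ne_top_of_le_ne_top ENNReal.ofReal_ne_top hun)⟩

end Consistency

/-! ### The restricted cross-validation posteriors. -/

namespace InvModel

variable {Θ : Type*} [MeasurableSpace Θ] {𝒳 : Set ℝ} {ν : Measure ℝ} (M : InvModel Θ 𝒳 ν)
  {n m : ℕ} (D : Resp n m) (i : Fin n) (b : ℝ)

theorem measurable_xPrior (h𝒳 : MeasurableSet 𝒳) :
    Measurable fun p : Θ × ℝ => M.xPrior b D i p.1 p.2 := by
  classical
  set s : Set (Θ × ℝ) := {p | p.2 ∈ 𝒳 ∧ M.H (M.η p.1 p.2) ∈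
    Icc (blockMean D i - b * blockSD D i / √m) (blockMean D i + b * blockSD D i / √m)} with hs
  have hsm : MeasurableSet s :=
    (measurable_snd h𝒳).inter ((M.H_meas.comp M.η_meas) measurableSet_Icc)
  have hvol : Measurable fun p : Θ × ℝ => volume (M.B b D i p.1) :=
    (measurable_measure_prodMk_left hsm).comp measurable_fst
  have hind : Measurable fun p : Θ × ℝ => (M.B b D i p.1).indicator (1 : ℝ → ℝ≥0∞) p.2 :=
    measurable_one.indicator hsm
  refine Measurable.ite (hvol (measurableSet_singleton 0)) ?_ (hind.div hvol)
  exact ((measurable_one.indicator h𝒳).comp measurable_snd).div_const _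

theorem measurable_xPrior_mul_block (h𝒳 : MeasurableSet 𝒳) :
    Measurable fun p : Θ × ℝ => M.xPrior b D i p.1 p.2 * M.block D p.1 i p.2 :=
  (M.measurable_xPrior D i b h𝒳).mul ((M.measurable_block i).comp
    (measurable_fst.prodMk (measurable_const.prodMk measurable_snd)))

theorem measurable_xEvid (h𝒳 : MeasurableSet 𝒳) : Measurable fun θ => M.xEvid b D i θ :=
  (M.measurable_xPrior_mul_block D i b h𝒳).lintegral_prod_right'

theorem measurable_xPost (h𝒳 : MeasurableSet 𝒳) :
    Measurable fun p : Θ × ℝ => M.xPost b D i p.1 p.2 :=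
  (M.measurable_xPrior_mul_block D i b h𝒳).div ((M.measurable_xEvid D i b h𝒳).comp measurable_fst)

theorem measurable_cvLik (h𝒳 : MeasurableSet 𝒳) (x : ℕ → ℝ) :
    Measurable fun θ => M.cvLik x b D i θ := by
  refine (Finset.measurable_prod _ fun l _ => ?_).mul (M.measurable_xEvid D i b h𝒳)
  exact (M.measurable_block l).comp
    (measurable_id.prodMk (measurable_const.prodMk measurable_const))

/-- The restricted inverse cross-validation posterior is a probability measure. -/
theorem isProbabilityMeasure_cvPost (h𝒳 : MeasurableSet 𝒳) (x : ℕ → ℝ) (S : Set Θ)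
    (h0 : M.cvNorm x b S D i ≠ 0) (ht : M.cvNorm x b S D i ≠ ∞) :
    IsProbabilityMeasure (M.cvPost x b S D i) := by
  have := M.prior_prob
  have hL := M.measurable_cvLik D i b h𝒳 x
  have hXL : Measurable fun p : Θ × ℝ => M.xPost b D i p.1 p.2 * M.cvLik x b D i p.1 :=
    (M.measurable_xPost D i b h𝒳).mul (hL.comp measurable_fst)
  constructor
  rw [cvPost, withDensity_apply _ MeasurableSet.univ, Measure.restrict_univ]
  simp_rw [div_eq_mul_inv]
  have hz : Measurable fun z => ∫⁻ θ in S, M.xPost b D i θ z * M.cvLik x b D i θ ∂M.prior :=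
    hXL.lintegral_prod_left'
  have hswap : ∫⁻ z, ∫⁻ θ in S, M.xPost b D i θ z * M.cvLik x b D i θ ∂M.prior
      = ∫⁻ θ in S, (∫⁻ z, M.xPost b D i θ z * M.cvLik x b D i θ) ∂M.prior := by
    rw [lintegral_lintegral_swap]
    exact (hXL.comp measurable_swap).aemeasurable
  rw [lintegral_mul_const _ hz, ← div_eq_mul_inv, hswap]
  have hint : ∫⁻ θ in S, (∫⁻ z, M.xPost b D i θ z * M.cvLik x b D i θ) ∂M.prior
      = M.cvNorm x b S D i := by
    refine lintegral_congr_ae ?_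
    filter_upwards [ae_lt_top hL ht] with θ hθ
    have hxp : Measurable fun z => M.xPrior b D i θ z * M.block D θ i z :=
      (M.measurable_xPrior_mul_block D i b h𝒳).comp (measurable_const.prodMk measurable_id)
    simp_rw [xPost, div_eq_mul_inv]
    rw [lintegral_mul_const _ (hxp.mul_const _), lintegral_mul_const _ hxp]
    change M.xEvid b D i θ * (M.xEvid b D i θ)⁻¹ * M.cvLik x b D i θ = M.cvLik x b D i θ
    -- The degenerate evidences cost nothing: if it is `0`, so is `cvLik`; if it is `∞`, then
    -- `cvLik`, finite almost everywhere, must be `0`.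
    rcases eq_or_ne (M.xEvid b D i θ) 0 with he | he
    · simp [cvLik, he]
    rcases eq_or_ne (M.xEvid b D i θ) ∞ with he' | he'
    · have hz : M.cvLik x b D i θ = 0 := by
        by_contra hne
        rw [cvLik, he'] at hne hθ
        rw [ENNReal.mul_top (left_ne_zero_of_mul hne)] at hθ
        exact lt_irrefl _ hθ
      rw [hz, mul_zero]
    · rw [ENNReal.mul_inv_cancel he he', one_mul]
  rw [hint, ENNReal.div_self h0 ht]

/-- Both branches of `xPrior` vanish off the covariate space, including the fallback for a null set
`B`. This is what makes the discrepancy terms bounded. -/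
theorem ae_cvPost_mem (h𝒳 : MeasurableSet 𝒳) (x : ℕ → ℝ) (S : Set Θ) :
    ∀ᵐ z ∂M.cvPost x b S D i, z ∈ 𝒳 := by
  rw [ae_iff]
  change M.cvPost x b S D i 𝒳ᶜ = 0
  rw [cvPost, withDensity_apply _ h𝒳.compl]
  refine setLIntegral_eq_zero h𝒳.compl fun z hz => ?_
  have hp : ∀ θ, M.xPrior b D i θ z = 0 := by
    intro θ
    unfold xPrior
    split_ifs with h
    · rw [indicator_of_notMem hz, ENNReal.zero_div]
    · rw [indicator_of_notMem fun h => hz h.1, ENNReal.zero_div]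
  simp [xPost, hp]

end InvModel

/-! ### Boundedness and concentration of the discrepancy. -/

theorem Discrepancy.measurable_term (T : Discrepancy) (c : ℝ) (μ : Measure ℝ) :
    Measurable (T.term c μ) := by
  cases T <;> unfold Discrepancy.term <;> fun_prop

/-- On a bounded covariate space the terms of the discrepancy are uniformly bounded. -/
theorem Discrepancy.exists_term_le (T : Discrepancy) {c : ℝ} (hc : 0 < c) {𝒳 : Set ℝ}
    (h𝒳 : Bornology.IsBounded 𝒳) :
    ∃ C : ℝ, ∀ μ : Measure ℝ, IsProbabilityMeasure μ → (∀ᵐ z ∂μ, z ∈ 𝒳) →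
      ∀ v ∈ 𝒳, T.term c μ v ∈ Icc 0 C := by
  obtain ⟨R, hR⟩ := h𝒳.exists_norm_le
  have key : ∀ μ : Measure ℝ, IsProbabilityMeasure μ → (∀ᵐ z ∂μ, z ∈ 𝒳) →
      ∀ v ∈ 𝒳, |v - ∫ z, z ∂μ| ≤ 2 * R := by
    intro μ _ hμ v hv
    have h1 : ‖∫ z, z ∂μ‖ ≤ R := by
      simpa using norm_integral_le_of_norm_le_const (hμ.mono fun z hz => hR z hz)
    have h2 := hR v hv
    calc _ ≤ ‖v‖ + ‖∫ z, z ∂μ‖ := norm_sub_le _ _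
      _ ≤ 2 * R := by linarith
  cases T with
  | absolute =>
    refine ⟨2 * R / √c, fun μ hp hμ v hv => ?_⟩
    have hV : 0 ≤ variance id μ := variance_nonneg _ _
    simp only [Discrepancy.term]
    refine ⟨by positivity, ?_⟩
    exact div_le_div₀ ((abs_nonneg _).trans (key μ hp hμ v hv)) (key μ hp hμ v hv)
      (Real.sqrt_pos.2 hc) (Real.sqrt_le_sqrt (by linarith))
  | squared =>
    refine ⟨(2 * R) ^ 2 / c, fun μ hp hμ v hv => ?_⟩
    have hV : 0 ≤ variance id μ := variance_nonneg _ _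
    simp only [Discrepancy.term]
    refine ⟨by positivity, ?_⟩
    refine div_le_div₀ (by positivity) ?_ hc (by linarith)
    rw [← sq_abs]
    exact pow_le_pow_left₀ (abs_nonneg _) (key μ hp hμ v hv) 2

/-- The weak law of large numbers for averages of bounded functions of independent coordinates. -/
theorem pi_average_deviation_le {n : ℕ} (hn : 0 < n) {μ : Fin n → Measure ℝ}
    [∀ i, IsProbabilityMeasure (μ i)] {f : Fin n → ℝ → ℝ} (hf : ∀ i, Measurable (f i)) {C : ℝ}
    (hC : ∀ i, ∀ᵐ z ∂μ i, f i z ∈ Icc 0 C) {δ : ℝ} (hδ : 0 < δ) :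
    ∃ E : ℝ, Measure.pi μ {w | δ ≤ |(1 / n) * ∑ i, f i (w i) - E|}
      ≤ ENNReal.ofReal ((C / 2) ^ 2 / δ ^ 2 / n) := by
  have hL : ∀ i, MemLp (f i) 2 (μ i) := fun i =>
    memLp_of_bounded (hC i) (hf i).aestronglyMeasurable 2
  set X : (Fin n → ℝ) → ℝ := ∑ i, fun w => f i (w i) with hX
  have hXL : MemLp X 2 (Measure.pi μ) :=
    memLp_finsetSum' _ fun i _ => (hL i).comp_measurePreserving (measurePreserving_eval μ i)
  have hvar : Var[X; Measure.pi μ] ≤ n * (C / 2) ^ 2 := by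
    rw [hX, variance_sum_pi hL]
    refine (Finset.sum_le_sum fun i _ =>
      variance_le_sq_of_bounded (hC i) (hf i).aemeasurable).trans_eq ?_
    simp
  have hn' : (0 : ℝ) < n := by exact_mod_cast hn
  -- Chebyshev's inequality for the sum at level `n * δ`; a variable with values in `[0, C]` has
  -- variance at most `(C / 2) ^ 2`.
  refine ⟨(1 / n) * (Measure.pi μ)[X], ?_⟩
  have hch := meas_ge_le_variance_div_sq hXL (mul_pos hn' hδ)
  refine (measure_mono fun w hw => ?_).trans (hch.trans (ENNReal.ofReal_le_ofReal ?_))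
  · have h1 : X w = ∑ i, f i (w i) := by simp [hX]
    have hw' : δ ≤ |(1 / n) * ∑ i, f i (w i) - (1 / n) * (Measure.pi μ)[X]| := hw
    rw [← mul_sub, abs_mul, abs_of_pos (by positivity), ← h1, one_div, le_inv_mul_iff₀ hn'] at hw'
    exact hw'
  · calc _ ≤ n * (C / 2) ^ 2 / (n * δ) ^ 2 := by gcongr
      _ = _ := by field_simp

/-! ### Iterated limits of expectations. -/

/-- Iterated limits of expectations of uniformly bounded functions, which need not be measurable. -/
theorem tendsto_curry_lintegral {Ω : Type*} [MeasurableSpace Ω] {P : Measure Ω}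
    [IsFiniteMeasure P] {F : ℕ → ℕ → Ω → ℝ≥0∞} {C : ℝ≥0∞} (hC : C ≠ ∞)
    (hF : ∀ᶠ m in atTop, ∀ n, ∀ᵐ ω ∂P, F m n ω ≤ C)
    (hlim : ∀ᵐ ω ∂P, ∀ᶠ m in atTop, Tendsto (fun n => F m n ω) atTop (𝓝 0)) :
    Tendsto (fun q : ℕ × ℕ => ∫⁻ ω, F q.1 q.2 ω ∂P)
      ((atTop : Filter ℕ).curry (atTop : Filter ℕ)) (𝓝 0) := by
  -- Measurable minorants with the same lower integrals replace the functions. Reverse Fatou in `n`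
  -- and then dominated convergence in `m` apply to them, and the domination and the limit pass to
  -- minorants.
  choose g hgm hgF hg using fun m n => exists_measurable_le_lintegral_eq P (F m n)
  have hCP : ∫⁻ _, C ∂P ≠ ∞ := by
    rw [lintegral_const]
    exact ENNReal.mul_ne_top hC (measure_ne_top P _)
  have hgC : ∀ᶠ m in atTop, ∀ n, g m n ≤ᵐ[P] fun _ => C := by
    filter_upwards [hF] with m hm n
    filter_upwards [hm n] with ω hω
    exact (hgF m n ω).trans hω
  have hG : Tendsto (fun m => ∫⁻ ω, limsup (fun n => g m n ω) atTop ∂P) atTop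
      (𝓝 (∫⁻ _, (0 : ℝ≥0∞) ∂P)) := by
    refine tendsto_lintegral_filter_of_dominated_convergence (fun _ => C)
      (Eventually.of_forall fun m => Measurable.limsup (hgm m)) ?_ hCP ?_
    · filter_upwards [hgC] with m hm
      filter_upwards [ae_all_iff.2 hm] with ω hω
      exact limsup_le_of_le (by isBoundedDefault) (Eventually.of_forall hω)
    · filter_upwards [hlim] with ω hω
      refine tendsto_const_nhds.congr' ?_
      filter_upwards [hω] with m hm
      exact (tendsto_of_tendsto_of_tendsto_of_le_of_le tendsto_const_nhds hm
        (fun _ => zero_le) fun n => hgF m n ω).limsup_eq.symm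
  rw [lintegral_zero] at hG
  rw [ENNReal.tendsto_nhds_zero]
  intro e he
  rw [eventually_curry_iff]
  filter_upwards [hgC, hG.eventually_lt_const he] with m hm hme
  filter_upwards [eventually_lt_of_limsup_lt
    ((limsup_lintegral_le _ (hgm m) hm hCP).trans_lt hme)] with n hn
  rw [hg]
  exact hn.le

/-! ### Posterior model probabilities, the fit event and `cFNR`. -/

theorem RespModel.post_le_one {Θ : Type*} [MeasurableSpace Θ] {𝒳 : Set ℝ} {ν : Measure ℝ}
    (M : RespModel Θ 𝒳 ν) (x : ℕ → ℝ) {n m : ℕ} (D : Resp n m) (A : Set Θ) : M.post x D A ≤ 1 :=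
  (ENNReal.div_le_div_right (setLIntegral_le_lintegral _ _) _).trans ENNReal.div_self_le_one

namespace Selection

variable {K : ℕ} {Θ : Fin K → Type*} [∀ k, MeasurableSpace (Θ k)] {𝒳 : Set ℝ} {ν : Measure ℝ}
  (S : Selection Θ 𝒳 ν)

theorem sum_postModel_eq {n m : ℕ} (D : Resp n m) :
    ∑ k, S.postModel k D
      = (∑ l, S.weight l * (S.M l).marg S.x D) / ∑ l, S.weight l * (S.M l).marg S.x D := by
  simp_rw [postModel, div_eq_mul_inv]
  rw [Finset.sum_mul]

theorem sum_postModel_le_one {n m : ℕ} (D : Resp n m) : ∑ k, S.postModel k D ≤ 1 :=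
  (S.sum_postModel_eq D).trans_le ENNReal.div_self_le_one

theorem postModel_le_one (k : Fin K) {n m : ℕ} (D : Resp n m) : S.postModel k D ≤ 1 :=
  (Finset.single_le_sum (fun _ _ => zero_le) (Finset.mem_univ k)).trans (S.sum_postModel_le_one D)

theorem weight_le_one [IsProbabilityMeasure S.mix] (hmix : ∀ᵐ p ∂S.mix, p ∈ stdSimplex ℝ (Fin K))
    (k : Fin K) : S.weight k ≤ 1 := by
  calc S.weight k ≤ ∫⁻ _, 1 ∂S.mix := by
        refine lintegral_mono_ae ?_
        filter_upwards [hmix] with p hp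
        rw [ENNReal.ofReal_le_one, ← hp.2]
        exact Finset.single_le_sum (fun i _ => hp.1 i) (Finset.mem_univ k)
    _ = 1 := by simp

/-- The distribution of the discrepancy concentrates, so that the slack `ε` makes a credible interval
of fixed positive level capture almost all of its mass. -/
theorem tendsto_refLaw_fit_compl (h𝒳 : IsCompact 𝒳) (k : Fin K) {m : ℕ} (D : ∀ n, Resp n m)
    (hcv : ∀ n (i : Fin n), (S.M k).cvNorm S.x S.b (S.region k) (D n) i ≠ 0 ∧
      (S.M k).cvNorm S.x S.b (S.region k) (D n) i ≠ ∞)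
    (hc : 0 < S.c) (hε : 0 < S.ε) {α : ℝ} (hα : α < 1)
    (hcred : ∀ n, 0 < n → ENNReal.ofReal (1 - α) ≤ S.refLaw k (D n)
        {w | S.disc k (D n) w ∈ Icc (S.lo k n m (D n)) (S.up k n m (D n))})
    (ha : ∀ᶠ n in atTop, |S.discObs k (D n) - S.a k| < S.ε / 2) :
    Tendsto (fun n => S.refLaw k (D n) (S.fit k (D n))ᶜ) atTop (𝓝 0) := by
  obtain ⟨C, hC⟩ := S.T.exists_term_le hc h𝒳.isBounded
  have hp : ∀ n (i : Fin n),
      IsProbabilityMeasure ((S.M k).cvPost S.x S.b (S.region k) (D n) i) := fun n i =>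
    (S.M k).isProbabilityMeasure_cvPost _ _ _ h𝒳.measurableSet _ _ (hcv n i).1 (hcv n i).2
  have hδ : 0 < S.ε / 4 := by linarith
  have hbound : Tendsto (fun n : ℕ => ENNReal.ofReal ((C / 2) ^ 2 / (S.ε / 4) ^ 2 / n)) atTop
      (𝓝 0) := by
    rw [← ENNReal.ofReal_zero]
    exact ENNReal.tendsto_ofReal (tendsto_const_div_atTop_nhds_zero_nat _)
  refine tendsto_of_tendsto_of_tendsto_of_le_of_le' tendsto_const_nhds hbound
    (Eventually.of_forall fun _ => zero_le) ?_
  filter_upwards [ha, eventually_gt_atTop 0,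
    hbound.eventually_lt_const (ENNReal.ofReal_pos.2 (sub_pos.2 hα))] with n han hn hbn
  have := hp n
  obtain ⟨E, hE⟩ := pi_average_deviation_le hn
    (fun i => S.T.measurable_term S.c ((S.M k).cvPost S.x S.b (S.region k) (D n) i))
    (fun i => ((S.M k).ae_cvPost_mem (D n) i S.b h𝒳.measurableSet S.x (S.region k)).mono
      (hC _ (hp n i) ((S.M k).ae_cvPost_mem (D n) i S.b h𝒳.measurableSet S.x (S.region k)))) hδ
  change S.refLaw k (D n) {w | S.ε / 4 ≤ |S.disc k (D n) w - E|} ≤ _ at hE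
  -- The credible event has mass at least `1 - α`, more than the deviation event, so it contains a
  -- point of small deviation. Hence `E` is within `ε/4` of the interval and typical draws are
  -- within `ε/2`; the observed discrepancy adds another `ε/2`, exhausting the slack.
  obtain ⟨w₀, hw₀, hw₀'⟩ : ∃ w, S.disc k (D n) w ∈ Icc (S.lo k n m (D n)) (S.up k n m (D n)) ∧
      |S.disc k (D n) w - E| < S.ε / 4 := by
    by_contra! h
    exact absurd ((hcred n hn).trans ((measure_mono fun w hw => h w hw).trans hE)) (not_le.2 hbn)
  refine (measure_mono fun w hw => ?_).trans hE
  by_contra hlt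
  have hlt' : |S.disc k (D n) w - E| < S.ε / 4 := not_le.1 hlt
  refine hw ?_
  rw [abs_lt] at hlt' hw₀' han
  constructor
  · linarith [hw₀.1]
  · linarith [hw₀.2]

section Limits

variable {m : ℕ} {D : ∀ n, Resp n m} {kt : Fin K}

/-- The normalizing sum is at least its term for `kt`, so the posterior probability is at most the
Bayes factor against `kt` times a constant. -/
theorem tendsto_postModel_zero [IsProbabilityMeasure S.mix]
    (hmix : ∀ᵐ p ∂S.mix, p ∈ stdSimplex ℝ (Fin K)) (hkt : S.weight kt ≠ 0) {k : Fin K}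
    (hk : Tendsto (fun n => (S.M k).marg S.x (D n) / (S.M kt).marg S.x (D n)) atTop (𝓝 0)) :
    Tendsto (fun n => S.postModel k (D n)) atTop (𝓝 0) := by
  have hw := S.weight_le_one hmix
  have hkt' : S.weight kt ≠ ∞ := ne_top_of_le_ne_top ENNReal.one_ne_top (hw kt)
  have hlim : Tendsto (fun n => (S.weight kt)⁻¹ *
      ((S.M k).marg S.x (D n) / (S.M kt).marg S.x (D n))) atTop (𝓝 0) := by
    simpa using ENNReal.Tendsto.const_mul hk (Or.inr (ENNReal.inv_ne_top.2 hkt))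
  refine tendsto_of_tendsto_of_tendsto_of_le_of_le tendsto_const_nhds hlim
    (fun _ => zero_le) fun n => ?_
  calc S.postModel k (D n)
      ≤ (S.M k).marg S.x (D n) / (S.weight kt * (S.M kt).marg S.x (D n)) :=
        ENNReal.div_le_div (mul_le_of_le_one_left' (hw k))
          (Finset.single_le_sum (f := fun l => S.weight l * (S.M l).marg S.x (D n))
            (fun _ _ => zero_le) (Finset.mem_univ kt))
    _ = _ := by
        rw [div_eq_mul_inv, div_eq_mul_inv, ENNReal.mul_inv (Or.inl hkt) (Or.inl hkt')]
        ring

theorem tendsto_postModel_one [IsProbabilityMeasure S.mix]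
    (hmix : ∀ᵐ p ∂S.mix, p ∈ stdSimplex ℝ (Fin K)) (hkt : S.weight kt ≠ 0)
    (hmarg : ∀ k, ∀ᶠ n in atTop, (S.M k).marg S.x (D n) ≠ 0 ∧ (S.M k).marg S.x (D n) ≠ ∞)
    (hsum : Tendsto (fun n => ∑ l ∈ Finset.univ.erase kt, S.postModel l (D n)) atTop (𝓝 0)) :
    Tendsto (fun n => S.postModel kt (D n)) atTop (𝓝 1) := by
  have h1 : Tendsto (fun n => 1 - ∑ l ∈ Finset.univ.erase kt, S.postModel l (D n)) atTop
      (𝓝 (1 - 0)) := ENNReal.Tendsto.sub tendsto_const_nhds hsum (Or.inl ENNReal.one_ne_top)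
  rw [tsub_zero] at h1
  refine h1.congr' ?_
  -- Nonzero and finite marginals exclude `0 / 0` and `∞ / ∞`, so the posterior model probabilities
  -- really sum to one.
  filter_upwards [eventually_all.2 hmarg] with n hn
  have hone : ∑ k, S.postModel k (D n) = 1 := by
    rw [sum_postModel_eq]
    refine ENNReal.div_self ?_ ?_
    · intro h0
      exact mul_ne_zero hkt (hn kt).1 (Finset.sum_eq_zero_iff.1 h0 kt (Finset.mem_univ kt))
    · exact ENNReal.sum_ne_top.2 fun l _ => ENNReal.mul_ne_top
        (ne_top_of_le_ne_top ENNReal.one_ne_top (S.weight_le_one hmix l)) (hn l).2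
  rw [← Finset.add_sum_erase _ _ (Finset.mem_univ kt)] at hone
  refine (ENNReal.eq_sub_of_add_eq ?_ hone).symm
  exact ne_top_of_le_ne_top ENNReal.one_ne_top (le_add_self.trans_eq hone)

end Limits

section Bounds

variable {n m : ℕ} (D : Resp n m)

/-- Each of the three parts is at most one. Any finite bound would do: it keeps `toReal` monotone
and dominates `cFNR`. -/
theorem v_inner_le {k : Fin K} (hp : IsProbabilityMeasure (S.refLaw k D)) :
    (∑ l ∈ Finset.univ.erase k, S.postModel l D)
      + S.postModel k D * (S.M k).post S.x D (S.region k)ᶜ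
      + S.postModel k D * (S.M k).post S.x D (S.region k) * S.refLaw k D (S.fit k D)ᶜ ≤ 3 := by
  have h1 := S.postModel_le_one k D
  have h2 : ∑ l ∈ Finset.univ.erase k, S.postModel l D ≤ 1 :=
    (Finset.sum_le_sum_of_subset (Finset.erase_subset _ _)).trans (S.sum_postModel_le_one D)
  calc _ ≤ (1 : ℝ≥0∞) + 1 * 1 + 1 * 1 * 1 := by
        gcongr
        · exact (S.M k).post_le_one S.x D _
        · exact (S.M k).post_le_one S.x D _
        · exact prob_le_one
    _ = 3 := by norm_num

theorem v_nonneg (k : Fin K) : 0 ≤ S.v k D := ENNReal.toReal_nonneg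

theorem v_le {k : Fin K} (hp : IsProbabilityMeasure (S.refLaw k D)) : S.v k D ≤ 3 := by
  have h := ENNReal.toReal_mono (by norm_num) (S.v_inner_le D hp)
  simpa [v] using h

/-- The alternative for `k` contains the event that another model `l` holds. With `l` the best model
this forces `v` for every wrong model above the threshold. -/
theorem postModel_le_v {k l : Fin K} (hp : IsProbabilityMeasure (S.refLaw k D)) (hl : l ≠ k) :
    (S.postModel l D).toReal ≤ S.v k D := by
  refine ENNReal.toReal_mono (ne_top_of_le_ne_top (by norm_num) (S.v_inner_le D hp)) ?_
  rw [add_assoc]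
  exact le_add_right (Finset.single_le_sum (f := fun l => S.postModel l D) (fun _ _ => zero_le)
    (Finset.mem_erase.2 ⟨hl, Finset.mem_univ l⟩))

theorem cFNR_eq_dHat : S.cFNR D = (∑ k, (1 - ((S.dHat D k : ℕ) : ℝ)) * S.v k D) /
    max (∑ k, (1 - ((S.dHat D k : ℕ) : ℝ))) 1 := by
  rw [cFNR, Finset.sum_eq_single (S.dHat D)]
  · simp [delta]
  · intro d _ hd
    simp [delta, hd]
  · simp

/-- When `kt` alone is not rejected, the numerator has a single term and the denominator is one. -/
theorem cFNR_eq_v {kt : Fin K} (h0 : S.v kt D ≤ S.β n m)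
    (h1 : ∀ k, k ≠ kt → S.β n m < S.v k D) : S.cFNR D = S.v kt D := by
  have hd : ∀ k, (1 - ((S.dHat D k : ℕ) : ℝ)) = if k = kt then 1 else 0 := by
    intro k
    by_cases hk : k = kt
    · subst hk
      simp [dHat, not_lt.2 h0]
    · simp [dHat, h1 k hk, hk]
  rw [cFNR_eq_dHat]
  simp_rw [hd]
  simp

theorem cFNR_le (hp : ∀ k, IsProbabilityMeasure (S.refLaw k D)) : S.cFNR D ≤ K * 3 := by
  have hd : ∀ k, 0 ≤ 1 - ((S.dHat D k : ℕ) : ℝ) ∧ 1 - ((S.dHat D k : ℕ) : ℝ) ≤ 1 := by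
    intro k
    have h : (S.dHat D k : ℕ) ≤ 1 := Nat.lt_succ_iff.1 (S.dHat D k).2
    have h' : ((S.dHat D k : ℕ) : ℝ) ≤ 1 := by exact_mod_cast h
    have h'' : (0 : ℝ) ≤ ((S.dHat D k : ℕ) : ℝ) := Nat.cast_nonneg _
    constructor <;> linarith
  rw [cFNR_eq_dHat]
  refine (div_le_self (Finset.sum_nonneg fun k _ =>
    mul_nonneg (hd k).1 (S.v_nonneg D k)) (le_max_right _ _)).trans ?_
  calc _ ≤ ∑ _k : Fin K, (3 : ℝ) := Finset.sum_le_sum fun k _ =>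
        (mul_le_of_le_one_left (S.v_nonneg D k) (hd k).2).trans (S.v_le D (hp k))
    _ = K * 3 := by simp

end Bounds

theorem isProbabilityMeasure_refLaw (h𝒳 : IsCompact 𝒳) (k : Fin K) {n m : ℕ} (D : Resp n m)
    (hcv : ∀ i : Fin n, (S.M k).cvNorm S.x S.b (S.region k) D i ≠ 0 ∧
      (S.M k).cvNorm S.x S.b (S.region k) D i ≠ ∞) : IsProbabilityMeasure (S.refLaw k D) := by
  have : ∀ i, IsProbabilityMeasure ((S.M k).cvPost S.x S.b (S.region k) D i) := fun i =>
    (S.M k).isProbabilityMeasure_cvPost _ _ _ h𝒳.measurableSet _ _ (hcv i).1 (hcv i).2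
  exact inferInstanceAs (IsProbabilityMeasure (Measure.pi _))

theorem tendsto_v_zero {m : ℕ} {D : ∀ n, Resp n m} {kt : Fin K}
    (hsum : Tendsto (fun n => ∑ l ∈ Finset.univ.erase kt, S.postModel l (D n)) atTop (𝓝 0))
    (hpost : Tendsto (fun n => (S.M kt).post S.x (D n) (S.region kt)ᶜ) atTop (𝓝 0))
    (hfit : Tendsto (fun n => S.refLaw kt (D n) (S.fit kt (D n))ᶜ) atTop (𝓝 0)) :
    Tendsto (fun n => S.v kt (D n)) atTop (𝓝 0) := by
  have h : Tendsto (fun n => (∑ l ∈ Finset.univ.erase kt, S.postModel l (D n))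
      + (S.M kt).post S.x (D n) (S.region kt)ᶜ + S.refLaw kt (D n) (S.fit kt (D n))ᶜ) atTop
      (𝓝 0) := by
    simpa using (hsum.add hpost).add hfit
  have h' := tendsto_of_tendsto_of_tendsto_of_le_of_le tendsto_const_nhds h
    (fun _ => zero_le) fun n => add_le_add (add_le_add
      (le_refl (∑ l ∈ Finset.univ.erase kt, S.postModel l (D n)))
      (mul_le_of_le_one_left' (a := (S.M kt).post S.x (D n) (S.region kt)ᶜ)
        (S.postModel_le_one kt (D n))))
      (mul_le_of_le_one_left' (a := S.refLaw kt (D n) (S.fit kt (D n))ᶜ)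
        (mul_le_one' (S.postModel_le_one kt (D n))
          ((S.M kt).post_le_one S.x (D n) (S.region kt))))
  exact (ENNReal.tendsto_toReal ENNReal.zero_ne_top).comp h'

end Selection

/-! ### Assembly of the main theorem. -/

theorem mainTheorem5 {K : ℕ} (hK : 1 < K)
    {𝒳 : Set ℝ} (h𝒳 : IsCompact 𝒳) (h𝒳pos : 0 < volume 𝒳)
    {ν : Measure ℝ} [SigmaFinite ν]
    {Θ₀ : Type*} [MeasurableSpace Θ₀] (M₀ : RespModel Θ₀ 𝒳 ν)
    {Θ : Fin K → Type*} [∀ k, MeasurableSpace (Θ k)] (S : Selection Θ 𝒳 ν)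
    {Ω : Type*} [MeasurableSpace Ω] (P : Measure Ω) [IsProbabilityMeasure P]
    -- the covariates and the responses, generated by the true model
    (hx : ∀ i, S.x i ∈ 𝒳)
    (y : ℕ → ℕ → Ω → ℝ) (hy : ∀ i j, Measurable (y i j))
    (hlaw : ∀ n m, P.map (obs y n m) = M₀.law S.x n m)
    -- the prior of the mixing probabilities
    [IsProbabilityMeasure S.mix] (hmix : ∀ᵐ p ∂S.mix, p ∈ stdSimplex ℝ (Fin K))
    -- Shalizi's conditions and the best model
    (hS : ∀ k, ∀ m, 1 < m → Shalizi (S.M k).toRespModel M₀ S.x P y m)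
    (kt : Fin K) (hkt : S.weight kt ≠ 0)
    (hbest : ∀ m, 1 < m → ∀ k, k ≠ kt →
      (S.M kt).klInf M₀ S.x m univ < (S.M k).klInf M₀ S.x m univ)
    -- the regions `Θ̃_k`
    (hreg : ∀ k, MeasurableSet (S.region k))
    (hsep : ∀ k, ∀ m, 1 < m →
      (S.M k).klInf M₀ S.x m univ < (S.M k).klInf M₀ S.x m (S.region k)ᶜ)
    -- the restricted cross-validation posteriors are well defined
    (hb : 1 ≤ S.b)
    (hcv : ∀ᵐ ω ∂P, ∀ n m, 1 < m → ∀ (k : Fin K) (i : Fin n),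
      (S.M k).cvNorm S.x S.b (S.region k) (obs y n m ω) i ≠ 0 ∧
      (S.M k).cvNorm S.x S.b (S.region k) (obs y n m ω) i ≠ ∞)
    -- the constants of the hypotheses: `a_k` is the iterated limit of `T^{(k)}(X_n)`
    (hc : 0 < S.c) (hε : 0 < S.ε)
    (ha : ∀ k, ∀ᵐ ω ∂P, Tendsto (fun q : ℕ × ℕ => S.discObs k (obs y q.2 q.1 ω))
      ((atTop : Filter ℕ).curry (atTop : Filter ℕ)) (𝓝 (S.a k)))
    -- the credible intervals of level `1 - α`
    (α : ℝ) (hα : α ∈ Ioo (0 : ℝ) 1)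
    (hlo : ∀ k n m, Measurable (S.lo k n m)) (hup : ∀ k n m, Measurable (S.up k n m))
    (hcred : ∀ᵐ ω ∂P, ∀ n m, 0 < n → 1 < m → ∀ k,
      ENNReal.ofReal (1 - α) ≤ S.refLaw k (obs y n m ω)
        {w | S.disc k (obs y n m ω) w ∈
          Icc (S.lo k n m (obs y n m ω)) (S.up k n m (obs y n m ω))})
    -- condition (A1)
    (hβ : ∀ n m, S.β n m ∈ Ioo (0 : ℝ) 1)
    (hβ_inf : 0 < liminf (fun q : ℕ × ℕ => S.β q.1 q.2) (atTop ×ˢ atTop))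
    (hβ_sup : limsup (fun q : ℕ × ℕ => S.β q.1 q.2) (atTop ×ˢ atTop) < 1) :
    -- `cFNR` tends to zero almost surely, as `n → ∞` and then `m → ∞`
    (∀ᵐ ω ∂P, ∀ᶠ m in atTop, Tendsto (fun n => S.cFNR (obs y n m ω)) atTop (𝓝 0)) ∧
    -- for large samples `cFNR` is the posterior probability of the alternative for the best model
    (∀ᵐ ω ∂P, ∀ᶠ m in atTop, ∀ᶠ n in atTop, S.cFNR (obs y n m ω) = S.v kt (obs y n m ω)) ∧
    -- `pBFNR` tends to zero, as `n → ∞` and then `m → ∞`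
    Tendsto (fun q : ℕ × ℕ => S.pBFNR M₀ q.2 q.1)
      ((atTop : Filter ℕ).curry (atTop : Filter ℕ)) (𝓝 0) := by

  -- Fixed separators with `β₀ > 0` and `β₁ < 1`: eventually `v` of the best model is below `β₀`,
  -- the threshold is between `β₀` and `β₁`, and the posterior probability of the best model exceeds
  -- `β₁`.
  obtain ⟨β₀, hβ₀, hβ₀'⟩ := exists_between hβ_inf
  obtain ⟨β₁, hβ₁, hβ₁'⟩ := exists_between hβ_sup
  have hev₀ : ∀ᶠ m in atTop, ∀ᶠ n in atTop, β₀ < S.β n m :=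
    -- A joint bound in `(n, m)` implies the iterated one; the swap puts `m` outside.
    (eventually_swap_iff.1 (eventually_lt_of_lt_liminf hβ₀'
      (isBoundedUnder_of ⟨0, fun q => (hβ q.1 q.2).1.le⟩))).curry
  have hev₁ : ∀ᶠ m in atTop, ∀ᶠ n in atTop, S.β n m < β₁ :=
    (eventually_swap_iff.1 (eventually_lt_of_limsup_lt hβ₁
      (isBoundedUnder_of ⟨1, fun q => (hβ q.1 q.2).2.le⟩))).curry
  have hprob : ∀ᵐ ω ∂P, ∀ n m, 1 < m → ∀ k, IsProbabilityMeasure (S.refLaw k (obs y n m ω)) := by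
    filter_upwards [hcv] with ω hω n m hm k
    exact S.isProbabilityMeasure_refLaw h𝒳 k _ (hω n m hm k)
  have hbf : ∀ᵐ ω ∂P, ∀ m, 1 < m → ∀ k, k ≠ kt → Tendsto (fun n =>
      (S.M k).marg S.x (obs y n m ω) / (S.M kt).marg S.x (obs y n m ω)) atTop (𝓝 0) := by
    simp_rw [ae_all_iff]
    exact fun m hm k hk => (hS kt m hm).tendsto_marg_div_marg (hS k m hm) hx hy
      (fun n => hlaw n m) (hbest m hm k hk)
  have hpost : ∀ᵐ ω ∂P, ∀ m, 1 < m → Tendsto (fun n =>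
      (S.M kt).post S.x (obs y n m ω) (S.region kt)ᶜ) atTop (𝓝 0) := by
    simp_rw [ae_all_iff]
    exact fun m hm => (hS kt m hm).tendsto_post hx hy (fun n => hlaw n m) (hreg kt).compl
      (hsep kt m hm)
  have hmarg : ∀ᵐ ω ∂P, ∀ m, 1 < m → ∀ k, ∀ᶠ n in atTop,
      (S.M k).marg S.x (obs y n m ω) ≠ 0 ∧ (S.M k).marg S.x (obs y n m ω) ≠ ∞ := by
    simp_rw [ae_all_iff]
    exact fun m hm k => (hS k m hm).eventually_marg_ne hx hy fun n => hlaw n m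
  have hmain : ∀ᵐ ω ∂P, ∀ᶠ m in atTop, Tendsto (fun n => S.v kt (obs y n m ω)) atTop (𝓝 0) ∧
      ∀ᶠ n in atTop, S.cFNR (obs y n m ω) = S.v kt (obs y n m ω) := by
    filter_upwards [hcv, hprob, hbf, hpost, hmarg, ha kt, hcred]
      with ω hcvω hpω hbω hpoω hmω haω hcω
    have hball := haω.eventually (Metric.ball_mem_nhds (S.a kt) (half_pos hε))
    rw [eventually_curry_iff] at hball
    filter_upwards [eventually_gt_atTop 1, hball, hev₀, hev₁] with m hm hobs hm₀ hm₁
    have hzero : ∀ k, k ≠ kt → Tendsto (fun n => S.postModel k (obs y n m ω)) atTop (𝓝 0) :=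
      fun k hk => S.tendsto_postModel_zero (D := fun n => obs y n m ω) hmix hkt (hbω m hm k hk)
    have hsum : Tendsto (fun n => ∑ l ∈ Finset.univ.erase kt, S.postModel l (obs y n m ω)) atTop
        (𝓝 0) := by
      have h := tendsto_finsetSum (Finset.univ.erase kt) fun l hl =>
        hzero l (Finset.mem_erase.1 hl).1
      simpa using h
    have hone := S.tendsto_postModel_one (D := fun n => obs y n m ω) hmix hkt (hmω m hm) hsum
    have hfit := S.tendsto_refLaw_fit_compl h𝒳 kt (fun n => obs y n m ω)
      (fun n i => hcvω n m hm kt i) hc hε hα.2 (fun n hn => hcω n m hn hm kt) hobs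
    have hv := S.tendsto_v_zero (D := fun n => obs y n m ω) hsum (hpoω m hm) hfit
    refine ⟨hv, ?_⟩
    have honeR : Tendsto (fun n => (S.postModel kt (obs y n m ω)).toReal) atTop (𝓝 1) :=
      (ENNReal.tendsto_toReal ENNReal.one_ne_top).comp hone
    filter_upwards [hv.eventually_lt_const hβ₀, hm₀, hm₁, honeR.eventually_const_lt hβ₁']
      with n h1 h2 h3 h4
    refine S.cFNR_eq_v _ (h1.trans h2).le fun k hk => h3.trans (h4.trans_le ?_)
    exact S.postModel_le_v _ (hpω n m hm k) hk.symm
  have hlim : ∀ᵐ ω ∂P, ∀ᶠ m in atTop,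
      Tendsto (fun n => S.cFNR (obs y n m ω)) atTop (𝓝 0) := by
    filter_upwards [hmain] with ω hω
    filter_upwards [hω] with m hm
    exact hm.1.congr' (hm.2.mono fun n hn => hn.symm)
  refine ⟨hlim, hmain.mono fun ω hω => hω.mono fun m hm => hm.2, ?_⟩
  refine tendsto_of_tendsto_of_tendsto_of_le_of_le tendsto_const_nhds
    (tendsto_curry_lintegral (P := P)
      (F := fun m n ω => ENNReal.ofReal (S.cFNR (obs y n m ω)))
      (C := ENNReal.ofReal (K * 3)) ENNReal.ofReal_ne_top ?_ ?_)
    (fun _ => zero_le) fun q => ?_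
  · filter_upwards [eventually_gt_atTop 1] with m hm n
    filter_upwards [hprob] with ω hω
    exact ENNReal.ofReal_le_ofReal (S.cFNR_le _ (hω n m hm))
  · filter_upwards [hlim] with ω hω
    filter_upwards [hω] with m hm
    simpa using ENNReal.tendsto_ofReal hm
  · rw [Selection.pBFNR, ← hlaw]
    -- For a pushforward this inequality needs no measurability of `cFNR`, and an upper bound is
    -- enough.
    exact lintegral_map_le _ _
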